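/- Let $q=p^k$ be a prime power ($p$ prime, $k\ge 1$) and let $t\ge 2$ be an integer. Let $N:\mathbb{F}_{q^{t-1}}\to\mathbb{F}_q$, $N(A)=A\cdot A^{q}\cdots A^{q^{t-2}}$, be the norm. The projective norm graph $\mathrm{NG}(q,t)$ has vertex set $\mathbb{F}_{q^{t-1}}\times\mathbb{F}_q^*$, and vertices $(A,a)$ and $(B,b)$ are adjacent if and only if $N(A+B)=ab$; it is taken together with its loops, i.e. $(A,a)$ is adjacent to itself when $N(2A)=a^2$. Let $\mathrm{Aut}(\mathrm{NG}(q,t))$ be the group of permutations of the vertex set preserving adjacency and non-adjacency, and let $Z_n$ denote the cyclic group of order $n$. (a) If $q$ is odd, then for every $C\in\mathbb{F}_{q^{t-1}}^*$, every $i\in\{1,\dots,k(t-1)\}$ and each choice of sign, the map $(X,x)\mapsto\bigl(C^2X^{p^i},\ \pm N(C)\,x^{p^i}\bigr)$ is an automorphism of $\mathrm{NG}(q,t)$. (b) If $q$ is even, then for every $C\in\mathbb{F}_{q^{t-1}}^*$, every $A\in\mathbb{F}_{q^{t-1}}$ and every $i\in\{1,\dots,k(t-1)\}$, the map $(X,x)\mapsto\bigl(C^2X^{p^i}+A,\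 N(C)\,x^{p^i}\bigr)$ is an automorphism of $\mathrm{NG}(q,t)$. (c) If $q>2$, then every automorphism of $\mathrm{NG}(q,t)$ is of the form given in (a) when $q$ is odd, and of the form given in (b) when $q$ is even. Moreover, for $q>2$ there is a group isomorphism (for suitable actions defining the semidirect products) \[ \mathrm{Aut}(\mathrm{NG}(q,t))\simeq \begin{cases} Z_{q^{t-1}-1}\rtimes Z_{k(t-1)} & \text{if } q \text{ and } t-1 \text{ are both odd},\\ \bigl(Z_2\times Z_{(q^{t-1}-1)/2}\bigr)\rtimes Z_{k(t-1)} & \text{if } q \text{ is odd and } t-1 \text{ is even},\\ \bigl((Z_p)^{k(t-1)}\rtimes Z_{q^{t-1}-1}\bigr)\rtimes Z_{k(t-1)} & \text{if } q \text{ is even}. \end{cases} \] -/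

import Mathlib

/-- Adjacency in the projective norm graph of a finite extension `L / K` of finite fields, on the
vertex set `L × Kˣ`: the vertices `(A, a)` and `(B, b)` are adjacent iff `N(A + B) = a * b`, where
`N` is the norm of `L / K` (for `|K| = q` and `[L : K] = t - 1` this is
`N(A) = A * A ^ q * ⋯ * A ^ (q ^ (t - 2))`, see `FiniteField.algebraMap_norm_eq_prod_pow`).
The graph is taken together with its loops: `(A, a)` is adjacent to itself iff
`N(2 * A) = a ^ 2`. -/
def NormGraphAdj (K L : Type*) [Field K] [Field L] [Algebra K L] (u v : L × Kˣ) : Prop :=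
  Algebra.norm K (u.1 + v.1) = (u.2 : K) * (v.2 : K)

/-- The automorphism group of the projective norm graph (with loops): all permutations of the
vertex set which preserve adjacency in both directions, with composition as multiplication. -/
abbrev NormGraphAut (K L : Type*) [Field K] [Field L] [Algebra K L] : Type _ :=
  NormGraphAdj K L ≃r NormGraphAdj K L

/-- The norm `N(C)` of a nonzero element `C` of `L`, as a nonzero element of `K`. -/
noncomputable def unitNorm (K : Type*) {L : Type*} [Field K] [Field L] [Algebra K L] (C : Lˣ) :
    Kˣ :=
  Units.map (Algebra.norm K) C

/-- The cyclic group `Z_n` of order `n` (used only for `n ≥ 1`), written multiplicatively. -/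
abbrev Cyc (n : ℕ) : Type := Multiplicative (ZMod n)

section PowerFunctions

variable {L : Type*} [Field L]

/-- The power functions `x ↦ x ^ e` with `e < |L|` on a finite field `L` are linearly
independent. -/
theorem linearIndependent_pow_fun [Finite L] :
    LinearIndependent L (fun (e : Fin (Nat.card L)) (x : L) => x ^ (e : ℕ)) := by
  have := Fintype.ofFinite L
  rw [Fintype.linearIndependent_iff]
  intro c hc i
  have key : (∑ e : Fin (Nat.card L), Polynomial.monomial (e : ℕ) (c e)) = 0 := by
    apply Polynomial.eq_zero_of_natDegree_lt_card_of_eval_eq_zero _ Function.injective_id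
    · intro x
      have := congrFun hc x
      simpa [Polynomial.eval_finsetSum, Finset.sum_apply] using this
    · rw [← Nat.card_eq_fintype_card]
      refine lt_of_le_of_lt (Polynomial.natDegree_sum_le_of_forall_le (n := Nat.card L - 1) _ _
        fun e _ => (Polynomial.natDegree_monomial_le _).trans (by have := e.2; omega)) ?_
      have := Nat.card_pos (α := L)
      omega
  have := congrArg (fun P => Polynomial.coeff P (i : ℕ)) key
  simpa [Polynomial.finsetSum_coeff, Polynomial.coeff_monomial, Fin.val_inj] using this

/-- The monomial function `x ↦ ∏ s, (x ^ q ^ s) ^ α s`. -/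
def qMonomial (L : Type*) [Field L] (q : ℕ) {n : ℕ} (α : Fin n → ℕ) : L → L :=
  fun x => ∏ s : Fin n, (x ^ q ^ (s : ℕ)) ^ α s

theorem qMonomial_eq_pow (q : ℕ) {n : ℕ} (α : Fin n → Fin q) (x : L) :
    qMonomial L q (fun s => (α s : ℕ)) x = x ^ (finFunctionFinEquiv α : ℕ) := by
  rw [finFunctionFinEquiv_apply, qMonomial, ← Finset.prod_pow_eq_pow_sum]
  exact Finset.prod_congr rfl fun s _ => by rw [← pow_mul, mul_comm]

theorem linearIndependent_qMonomial [Finite L] {q n : ℕ} (hQ : Nat.card L = q ^ n) :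
    LinearIndependent L (fun α : Fin n → Fin q => qMonomial L q (fun s => (α s : ℕ))) := by
  have h := (linearIndependent_pow_fun (L := L)).comp
    (fun α : Fin n → Fin q => Fin.cast hQ.symm (finFunctionFinEquiv α))
    (fun α β h => by simpa using h)
  convert h using 1
  funext α x
  simp [qMonomial_eq_pow]

theorem linearIndepOn_qMonomial [Finite L] {q n : ℕ} (hQ : Nat.card L = q ^ n) :
    LinearIndepOn L (fun α : Fin n → ℕ => qMonomial L q α) {α | ∀ s, α s < q} := by
  have h := (linearIndependent_qMonomial (L := L) hQ).comp
    (fun α : {α : Fin n → ℕ | ∀ s, α s < q} => fun s => (⟨α.1 s, α.2 s⟩ : Fin q))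
    (fun α β h => by
      apply Subtype.ext
      funext s
      simpa using congrFun h s)
  exact h

end PowerFunctions

section NormPowers

variable (K L : Type*) [Field K] [Field L] [Algebra K L]

open Classical in
/-- The exponents `i < q` such that `X ^ i` occurs in `(X + 1) ^ m` over `L`. -/
noncomputable def binomExp (q m : ℕ) : Finset (Fin q) :=
  Finset.univ.filter fun i => ((m.choose i : ℕ) : L) ≠ 0

/-- The exponent vectors of the monomials occurring in `x ↦ N(x - Y) ^ m`. -/
noncomputable def normExp (q n m : ℕ) : Finset (Fin n → Fin q) :=
  Fintype.piFinset fun _ => binomExp L q m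

/-- The `L`-span of the functions `x ↦ N(x - Y) ^ m`. -/
noncomputable def normPowSpan (m : ℕ) : Submodule L (L → L) :=
  Submodule.span L (Set.range fun (Y x : L) => algebraMap K L (Algebra.norm K (x - Y)) ^ m)

variable {K L}

theorem mem_binomExp {q m : ℕ} {i : Fin q} :
    i ∈ binomExp L q m ↔ ((m.choose i : ℕ) : L) ≠ 0 := by
  simp [binomExp]

theorem mem_normExp {q n m : ℕ} {α : Fin n → Fin q} :
    α ∈ normExp L q n m ↔ ∀ s, ((m.choose (α s) : ℕ) : L) ≠ 0 := by
  simp [normExp, mem_binomExp]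

theorem le_of_mem_normExp {q n m : ℕ} {α : Fin n → Fin q} (h : α ∈ normExp L q n m) (s : Fin n) :
    (α s : ℕ) ≤ m := by
  by_contra hlt
  exact mem_normExp.mp h s (by rw [Nat.choose_eq_zero_of_lt (by omega)]; simp)

theorem card_normExp (q n m : ℕ) : (normExp L q n m).card = (binomExp L q m).card ^ n := by
  simp [normExp, Fintype.card_piFinset]

theorem sub_pow_eq_sum_binomExp {q m : ℕ} (hm : m < q) (a b : L) :
    (a - b) ^ m =
      ∑ i ∈ binomExp L q m, a ^ (i : ℕ) * ((-1) ^ (m - i) * (m.choose i : ℕ)) * b ^ (m - i) := by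
  have h1 : (a - b) ^ m =
      ∑ i : Fin q, a ^ (i : ℕ) * ((-1) ^ (m - i) * (m.choose i : ℕ)) * b ^ (m - i) := by
    rw [sub_eq_add_neg, add_pow, Fin.sum_univ_eq_sum_range
      (fun i => a ^ i * ((-1) ^ (m - i) * (m.choose i : L)) * b ^ (m - i))]
    rw [← Finset.sum_subset (Finset.range_subset_range.mpr (Nat.succ_le_of_lt hm))]
    · refine Finset.sum_congr rfl fun i _ => ?_
      rw [neg_pow b]; ring
    · intro i _ hi
      rw [Nat.choose_eq_zero_of_lt (by simpa using hi)]
      simp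
  rw [h1]
  symm
  refine Finset.sum_subset (Finset.subset_univ _) fun i _ hi => ?_
  rw [mem_binomExp, not_not] at hi
  simp [hi]

variable {p k q n m : ℕ} [Fact p.Prime] [CharP L p]

theorem map_normPowSpan_one (f : L ≃ L) {c : L} (hc : c ≠ 0)
    (hf : ∀ X Y, algebraMap K L (Algebra.norm K (f X - f Y)) =
      c * algebraMap K L (Algebra.norm K (X - Y)) ^ m) :
    (normPowSpan K L 1).map (LinearEquiv.funCongrLeft L L f).toLinearMap = normPowSpan K L m := by
  have hkey (Y : L) : (fun x => algebraMap K L (Algebra.norm K (f x - f Y)) ^ 1) =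
      c • fun x => algebraMap K L (Algebra.norm K (x - Y)) ^ m := by
    funext x
    simp [hf]
  rw [normPowSpan, Submodule.map_span]
  apply le_antisymm
  · refine Submodule.span_le.mpr ?_
    rintro _ ⟨_, ⟨Y, rfl⟩, rfl⟩
    obtain ⟨Y, rfl⟩ := f.surjective Y
    change (fun x => algebraMap K L (Algebra.norm K (f x - f Y)) ^ 1) ∈ normPowSpan K L m
    rw [hkey]
    exact Submodule.smul_mem _ _ (Submodule.subset_span ⟨Y, rfl⟩)
  · refine Submodule.span_le.mpr ?_
    rintro _ ⟨Y, rfl⟩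
    rw [SetLike.mem_coe, ← Submodule.smul_mem_iff _ hc, ← hkey]
    exact Submodule.subset_span ⟨_, ⟨f Y, rfl⟩, rfl⟩

theorem binomExp_one (hq : 1 < q) : (binomExp L q 1).card = 2 := by
  rw [Finset.card_eq_two]
  refine ⟨⟨0, by omega⟩, ⟨1, hq⟩, by simp, ?_⟩
  ext i
  rw [mem_binomExp]
  obtain ⟨_ | _ | i, hi⟩ := i
  · simp
  · simp
  · simp [Nat.choose_eq_zero_of_lt]

theorem choose_prime_pow_mul_ne_zero (r u : ℕ) (hu : ¬ p ∣ u) :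
    (((p ^ r * u).choose (p ^ r) : ℕ) : L) ≠ 0 := by
  have hp : 0 < p := (Fact.out : p.Prime).pos
  rw [Ne, CharP.cast_eq_zero_iff L p]
  induction r with
  | zero => simpa using hu
  | succ r ih =>
    rw [(Choose.choose_modEq_choose_mod_mul_choose_div_nat (p := p)).dvd_iff (dvd_refl p)]
    rw [pow_succ', mul_assoc]
    simpa [hp] using ih

theorem eq_prime_pow_of_card_binomExp (hm0 : 0 < m) (hm : m < q)
    (h : (binomExp L q m).card = 2) : ∃ r, m = p ^ r := by
  obtain ⟨r, u, hu, rfl⟩ := Nat.exists_eq_pow_mul_and_not_dvd hm0.ne' p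
    (Fact.out : p.Prime).ne_one
  refine ⟨r, ?_⟩
  by_contra hne
  have hp : 0 < p ^ r := pow_pos (Fact.out : p.Prime).pos r
  have hu0 : 0 < u := Nat.pos_of_mul_pos_left hm0
  have hlt : p ^ r < p ^ r * u := lt_of_le_of_ne (Nat.le_mul_of_pos_right _ hu0) (Ne.symm hne)
  have hsub : ({⟨0, by omega⟩, ⟨p ^ r, by omega⟩, ⟨p ^ r * u, hm⟩} : Finset (Fin q)) ⊆
      binomExp L q (p ^ r * u) := by
    intro i hi
    rw [mem_binomExp]
    simp only [Finset.mem_insert, Finset.mem_singleton] at hi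
    rcases hi with rfl | rfl | rfl
    · simp
    · exact choose_prime_pow_mul_ne_zero r u hu
    · simp
  have := Finset.card_le_card hsub
  rw [h, Finset.card_eq_three.mpr ⟨_, _, _, ?_, ?_, ?_, rfl⟩] at this
  · omega
  all_goals simp only [ne_eq, Fin.mk.injEq]; omega

variable [Finite L]

theorem norm_sub_pow_eq_sum (hq : q = p ^ k) (hK : Nat.card K = q)
    (hL : Module.finrank K L = n) (hm : m < q) (x Y : L) :
    algebraMap K L (Algebra.norm K (x - Y)) ^ m =
      ∑ α ∈ normExp L q n m, (∏ s : Fin n, (-1) ^ (m - α s) * (m.choose (α s) : L)) *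
        qMonomial L q (fun s => m - α s) Y * qMonomial L q (fun s => (α s : ℕ)) x := by
  rw [FiniteField.algebraMap_norm_eq_prod_pow, hL, hK, Finset.prod_range, ← Finset.prod_pow]
  have h (s : Fin n) : (x - Y) ^ q ^ (s : ℕ) = x ^ q ^ (s : ℕ) - Y ^ q ^ (s : ℕ) := by
    rw [hq, ← pow_mul]
    exact sub_pow_expChar_pow _ _ _
  simp_rw [h, sub_pow_eq_sum_binomExp hm, Finset.prod_univ_sum]
  refine Finset.sum_congr rfl fun α _ => ?_
  simp only [qMonomial, Finset.prod_mul_distrib]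
  ring

theorem normPowSpan_eq (hq : q = p ^ k) (hK : Nat.card K = q)
    (hL : Module.finrank K L = n) (hm : m < q) :
    normPowSpan K L m = Submodule.span L (Set.range fun α : normExp L q n m =>
      qMonomial L q (fun s => (α.1 s : ℕ))) := by
  have hQ : Nat.card L = q ^ n := by
    have := Module.natCard_eq_pow_finrank (K := K) (V := L)
    rw [this, hK, hL]
  apply le_antisymm
  · refine Submodule.span_le.mpr ?_
    rintro _ ⟨Y, rfl⟩
    have : (fun x : L => algebraMap K L (Algebra.norm K (x - Y)) ^ m) =
        ∑ α ∈ normExp L q n m, ((∏ s : Fin n, (-1) ^ (m - α s) * (m.choose (α s) : L)) *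
        qMonomial L q (fun s => m - α s) Y) • qMonomial L q (fun s => (α s : ℕ)) := by
      funext x
      rw [norm_sub_pow_eq_sum hq hK hL hm]
      simp [Finset.sum_apply]
    simp only [this]
    exact Submodule.sum_mem _ fun α hα => Submodule.smul_mem _ _
      (Submodule.subset_span ⟨⟨α, hα⟩, rfl⟩)
  · refine Submodule.span_le.mpr ?_
    rintro _ ⟨α, rfl⟩
    by_contra hα
    obtain ⟨l, hl, hker⟩ := Submodule.exists_le_ker_of_notMem hα
    apply hl
    have h0 (Y : L) : ∑ β : normExp L q n m,
        ((∏ s : Fin n, (-1) ^ (m - β.1 s) * (m.choose (β.1 s) : L)) *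
          l (qMonomial L q (fun s => (β.1 s : ℕ)))) * qMonomial L q (fun s => m - β.1 s) Y = 0 := by
      have := hker (Submodule.subset_span ⟨Y, rfl⟩)
      rw [LinearMap.mem_ker] at this
      have hfun : (fun x : L => algebraMap K L (Algebra.norm K (x - Y)) ^ m) =
        ∑ α : normExp L q n m, ((∏ s : Fin n, (-1) ^ (m - α.1 s) * (m.choose (α.1 s) : L)) *
        qMonomial L q (fun s => m - α.1 s) Y) • qMonomial L q (fun s => (α.1 s : ℕ)) := by
        funext x
        rw [norm_sub_pow_eq_sum hq hK hL hm, ← Finset.sum_coe_sort]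
        simp [Finset.sum_apply]
      simp only [hfun, map_sum, map_smul, smul_eq_mul] at this
      rw [← this]
      exact Finset.sum_congr rfl fun β _ => by ring
    have hLI : LinearIndependent L
        (fun β : normExp L q n m => qMonomial L q (fun s => m - β.1 s)) := by
      refine (linearIndepOn_qMonomial hQ).comp (fun β : normExp L q n m =>
        (⟨fun s => m - β.1 s, fun s => (Nat.sub_le _ _).trans_lt hm⟩ : {α : Fin n → ℕ | ∀ s, α s < q})) ?_
      intro β γ h
      apply Subtype.ext
      funext s
      have := congrFun (congrArg Subtype.val h) s
      simp only at this
      have h1 := le_of_mem_normExp β.2 s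
      have h2 := le_of_mem_normExp γ.2 s
      apply Fin.ext
      omega
    have := Fintype.linearIndependent_iff.mp hLI _ (by
      funext Y
      simpa [Finset.sum_apply] using h0 Y) α
    refine (mul_eq_zero.mp this).resolve_left ?_
    rw [Finset.prod_eq_zero_iff]
    rintro ⟨s, -, hs⟩
    exact mul_ne_zero (pow_ne_zero _ (by simp)) (mem_normExp.mp α.2 s) hs

theorem finrank_normPowSpan (hq : q = p ^ k) (hK : Nat.card K = q)
    (hL : Module.finrank K L = n) (hm : m < q) :
    Module.finrank L (normPowSpan K L m) = (binomExp L q m).card ^ n := by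
  have hQ : Nat.card L = q ^ n := by
    have := Module.natCard_eq_pow_finrank (K := K) (V := L)
    rw [this, hK, hL]
  rw [normPowSpan_eq hq hK hL hm, finrank_span_eq_card, Fintype.card_coe, card_normExp]
  exact (linearIndependent_qMonomial hQ).comp (fun α : normExp L q n m => α.1)
    Subtype.val_injective

/-- If a bijection `f` of `L` satisfies `N(f X - f Y) = c * N(X - Y) ^ m` with `1 ≤ m < |K|`, then
`m` is a power of the characteristic. -/
theorem exponent_eq_prime_pow (hq : q = p ^ k) (hK : Nat.card K = q)
    (hL : Module.finrank K L = n) (hn : n ≠ 0) (hm0 : 0 < m) (hm : m < q) (f : L ≃ L) {c : L}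
    (hc : c ≠ 0) (hf : ∀ X Y, algebraMap K L (Algebra.norm K (f X - f Y)) =
      c * algebraMap K L (Algebra.norm K (X - Y)) ^ m) : ∃ r, m = p ^ r := by
  refine eq_prime_pow_of_card_binomExp (L := L) hm0 hm (Nat.pow_left_injective hn ?_)
  simp only
  rw [← finrank_normPowSpan hq hK hL hm, ← map_normPowSpan_one f hc hf,
    LinearEquiv.finrank_map_eq, finrank_normPowSpan hq hK hL (by omega), binomExp_one (by omega)]

end NormPowers

section NormRigidity

open MvPolynomial

variable {K L : Type*} [Field K] [Field L] [Algebra K L]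
variable {p k q n m : ℕ} [Fact p.Prime] [CharP L p]

/-- Evaluation of a polynomial in `n` variables at `(x, x ^ q, …, x ^ q ^ (n - 1))`. -/
noncomputable def frobEval (L : Type*) [Field L] (q n : ℕ) :
    MvPolynomial (Fin n) L →ₐ[L] (L → L) :=
  aeval fun s x => x ^ q ^ (s : ℕ)

theorem frobEval_apply (P : MvPolynomial (Fin n) L) :
    frobEval L q n P = ∑ α ∈ P.support, P.coeff α • qMonomial L q α := by
  funext x
  rw [frobEval, aeval_def, eval₂_eq']
  simp [Finset.sum_apply, qMonomial, Finset.prod_apply]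

/-- A polynomial of degree at most one in the variable `i` and degree zero in the others is
affine. -/
theorem frobEval_of_degreeOf (P : MvPolynomial (Fin n) L) (i : Fin n)
    (hi : P.degreeOf i ≤ 1) (hne : ∀ j ≠ i, P.degreeOf j = 0) :
    ∃ a b : L, ∀ x, frobEval L q n P x = a * x ^ q ^ (i : ℕ) + b := by
  have hs : (0 : Fin n →₀ ℕ) ≠ Finsupp.single i 1 :=
    (Finsupp.single_ne_zero.mpr one_ne_zero).symm
  have hP : P = C (P.coeff (Finsupp.single i 1)) * X i + C (P.coeff 0) := by
    ext α
    by_cases hα : α ∈ P.support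
    · have h1 : α = Finsupp.single i (α i) := by
        ext j
        by_cases hj : j = i
        · simp [hj]
        · have := monomial_le_degreeOf j hα
          rw [hne j hj] at this
          rw [Finsupp.single_eq_of_ne hj]
          omega
      have h2 := (monomial_le_degreeOf i hα).trans hi
      have h3 : α i = 0 ∨ α i = 1 := by omega
      rcases h3 with h | h
      · rw [h] at h1
        simp [h1, coeff_C_mul, coeff_X, coeff_C]
      · rw [h] at h1
        simp [h1, coeff_C_mul, coeff_X, coeff_C, hs]
    · have h0 := notMem_support_iff.mp hα
      rw [h0, coeff_add, coeff_C_mul, coeff_X, coeff_C]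
      split_ifs with h1 h2 h2
      · exact absurd (h2.trans h1.symm) hs
      · rw [h1, h0]; simp
      · rw [h2, h0]; simp
      · simp
  refine ⟨P.coeff (Finsupp.single i 1), P.coeff 0, fun x => ?_⟩
  conv_lhs => rw [hP]
  simp [frobEval]

variable [Finite L]

theorem frobEval_injOn (hQ : Nat.card L = q ^ n) {P R : MvPolynomial (Fin n) L}
    (hP : ∀ s, P.degreeOf s < q) (hR : ∀ s, R.degreeOf s < q)
    (h : frobEval L q n P = frobEval L q n R) : P = R := by
  rw [← sub_eq_zero]
  have hD (s : Fin n) : (P - R).degreeOf s < q :=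
    (degreeOf_sub_le s P R).trans_lt (max_lt (hP s) (hR s))
  generalize hS : P - R = S at hD
  have hzero : frobEval L q n S = 0 := by rw [← hS, map_sub, h, sub_self]
  rw [frobEval_apply] at hzero
  have hLI := (linearIndepOn_qMonomial (L := L) hQ).comp
    (fun α : S.support => (⟨fun s => α.1 s, fun s =>
      (monomial_le_degreeOf s α.2).trans_lt (hD s)⟩ : {α : Fin n → ℕ | ∀ s, α s < q}))
    (fun α β h => by
      apply Subtype.ext
      ext s
      exact congrFun (congrArg Subtype.val h) s)
  rw [← Finset.sum_coe_sort] at hzero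
  have := Fintype.linearIndependent_iff.mp hLI (fun α => S.coeff α.1) hzero
  ext α
  by_contra hα
  exact hα (this ⟨α, mem_support_iff.mpr hα⟩)

theorem exists_frobEval_eq_of_mem_normPowSpan_one (hq : q = p ^ k) (hK : Nat.card K = q)
    (hL : Module.finrank K L = n) (hq1 : 1 < q) {v : L → L} (hv : v ∈ normPowSpan K L 1) :
    ∃ P : MvPolynomial (Fin n) L, (∀ s, P.degreeOf s ≤ 1) ∧ frobEval L q n P = v := by
  rw [normPowSpan_eq hq hK hL hq1] at hv
  suffices h : v ∈ (restrictDegree (Fin n) L 1).map (frobEval L q n).toLinearMap by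
    obtain ⟨P, hP, rfl⟩ := h
    refine ⟨P, fun s => degreeOf_le_iff.mpr fun α hα => ?_, rfl⟩
    exact (mem_restrictDegree _ _ _).mp hP α hα s
  refine Submodule.span_le.mpr ?_ hv
  rintro _ ⟨α, rfl⟩
  refine ⟨monomial (Finsupp.equivFunOnFinite.symm fun s => (α.1 s : ℕ)) 1, ?_, ?_⟩
  · rw [SetLike.mem_coe, mem_restrictDegree]
    intro β hβ s
    rw [Finset.mem_singleton.mp (support_monomial_subset hβ)]
    exact le_of_mem_normExp α.2 s
  · funext x
    simp [frobEval, aeval_monomial, qMonomial, Finsupp.prod_fintype]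

theorem qMonomial_mem_normPowSpan_one (hq : q = p ^ k) (hK : Nat.card K = q)
    (hL : Module.finrank K L = n) (hq1 : 1 < q) (α : Fin n → ℕ) (hα : ∀ s, α s ≤ 1) :
    qMonomial L q α ∈ normPowSpan K L 1 := by
  rw [normPowSpan_eq hq hK hL hq1]
  refine Submodule.subset_span ⟨⟨fun s => ⟨α s, (hα s).trans_lt hq1⟩, ?_⟩, rfl⟩
  rw [mem_normExp]
  intro s
  have : α s = 0 ∨ α s = 1 := by have := hα s; omega
  rcases this with h | h <;> simp [h]

/-- A bijection `f` of `L` with `N(f X - f Y) = c * N(X - Y)` is affine over a power of the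
`q`-Frobenius, if `q = |K| > 2`. -/
theorem eq_frobenius_affine_of_norm_sub (hq : q = p ^ k) (hK : Nat.card K = q)
    (hL : Module.finrank K L = n) (hn : n ≠ 0) (hq2 : 2 < q) (f : L ≃ L) {c : L} (hc : c ≠ 0)
    (hf : ∀ X Y, algebraMap K L (Algebra.norm K (f X - f Y)) =
      c * algebraMap K L (Algebra.norm K (X - Y))) :
    ∃ (a b : L) (i : ℕ), ∀ x, f x = a * x ^ q ^ i + b := by
  have hQ : Nat.card L = q ^ n := by
    have := Module.natCard_eq_pow_finrank (K := K) (V := L)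
    rw [this, hK, hL]
  have hmem (α : Fin n → ℕ) (hα : ∀ s, α s ≤ 1) : qMonomial L q α ∘ f ∈ normPowSpan K L 1 := by
    rw [← map_normPowSpan_one (m := 1) f hc (fun X Y => by rw [hf, pow_one])]
    exact ⟨_, qMonomial_mem_normPowSpan_one hq hK hL (by omega) α hα, rfl⟩
  have hpow (s : Fin n) (x : L) : qMonomial L q (Pi.single s 1) x = x ^ q ^ (s : ℕ) := by
    rw [qMonomial, Finset.prod_eq_single s]
    · simp
    · intro j _ hj; simp [hj]
    · simp
  have hF (s : Fin n) : ∃ P : MvPolynomial (Fin n) L, (∀ j, P.degreeOf j ≤ 1) ∧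
      frobEval L q n P = fun x => f x ^ q ^ (s : ℕ) := by
    obtain ⟨P, hP, hP'⟩ := exists_frobEval_eq_of_mem_normPowSpan_one hq hK hL (by omega)
      (hmem (Pi.single s 1) fun j => by
        by_cases h : j = s
        · subst h; simp
        · simp [h])
    exact ⟨P, hP, hP'.trans (funext fun x => hpow s (f x))⟩
  choose F hFdeg hFeval using hF
  have hinj (s : Fin n) : Function.Injective fun x : L => x ^ q ^ (s : ℕ) := by
    intro x y h
    have h' : x ^ p ^ (k * s) = y ^ p ^ (k * s) := by rw [pow_mul, ← hq]; exact h
    have := iterateFrobenius_inj L p (k * s)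
    exact this (by simpa [iterateFrobenius_def] using h')
  have hex (s : Fin n) : ∃ i, (F s).degreeOf i ≠ 0 := by
    by_contra! h
    obtain ⟨a, b, hab⟩ := frobEval_of_degreeOf (q := q) (F s) ⟨0, Nat.pos_of_ne_zero hn⟩
      (by rw [h]; omega) (fun j _ => h j)
    have hC : F s = C ((F s).coeff 0) := by
      ext α
      rw [coeff_C]
      split_ifs with h0
      · rw [h0]
      · by_contra hα
        apply h0
        ext j
        have := monomial_le_degreeOf j (mem_support_iff.mpr hα)
        rw [h j] at this
        simp only [Finsupp.coe_zero, Pi.zero_apply]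
        omega
    have h01 := ((hinj s).comp f.injective).ne (zero_ne_one (α := L))
    apply h01
    change (fun x => f x ^ q ^ (s : ℕ)) 0 = (fun x => f x ^ q ^ (s : ℕ)) 1
    rw [← hFeval s, hC]
    simp [frobEval]
  have hne (s : Fin n) : F s ≠ 0 := by
    obtain ⟨i, hi⟩ := hex s
    exact ne_zero_of_degreeOf_ne_zero hi
  have hdisj (s t : Fin n) (hst : s ≠ t) (i : Fin n) :
      (F s).degreeOf i + (F t).degreeOf i ≤ 1 := by
    rw [← degreeOf_mul_eq (hne s) (hne t)]
    obtain ⟨G, hG, hG'⟩ := exists_frobEval_eq_of_mem_normPowSpan_one hq hK hL (by omega)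
      (hmem (Pi.single s 1 + Pi.single t 1) fun j => by
        by_cases h : j = s
        · subst h; simp [hst]
        · by_cases h' : j = t
          · subst h'; simp [h]
          · simp [h, h'])
    have hGF : F s * F t = G := by
      refine frobEval_injOn hQ (fun j => ?_) (fun j => (hG j).trans_lt (by omega)) ?_
      · refine (degreeOf_mul_le j _ _).trans_lt ?_
        have := hFdeg s j
        have := hFdeg t j
        omega
      · rw [hG', map_mul, hFeval, hFeval]
        funext x
        rw [Pi.mul_apply, Function.comp_apply, ← hpow, ← hpow]
        simp only [qMonomial, Pi.add_apply, pow_add, Finset.prod_mul_distrib]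
    rw [hGF]
    exact hG i
  choose σ hσ using hex
  have hσinj : Function.Injective σ := by
    intro s t h
    by_contra hst
    have h1 := hdisj s t hst (σ s)
    have h2 := hσ s
    have h3 := hσ t
    rw [← h] at h3
    omega
  have hσsurj := Finite.surjective_of_injective hσinj
  set z : Fin n := ⟨0, Nat.pos_of_ne_zero hn⟩
  obtain ⟨a, b, hab⟩ := frobEval_of_degreeOf (q := q) (F z) (σ z) (hFdeg z _) (fun j hj => by
    obtain ⟨t, rfl⟩ := hσsurj j
    have h1 := hdisj z t (fun h => hj (by rw [h])) (σ t)
    have h2 := hσ t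
    omega)
  refine ⟨a, b, σ z, fun x => ?_⟩
  rw [← hab, hFeval]
  simp [z]

/-- If `|K| > 2`, a bijection `f` of `L` with `N(f X - f Y) = c * N(X - Y) ^ m` is affine over a
power of the Frobenius. -/
theorem eq_frobenius_affine_of_norm_sub_pow (hq : q = p ^ k) (hK : Nat.card K = q)
    (hL : Module.finrank K L = n) (hn : n ≠ 0) (hq2 : 2 < q) (hm0 : 0 < m) (hm : m < q)
    (f : L ≃ L) {c : L} (hc : c ≠ 0)
    (hf : ∀ X Y, algebraMap K L (Algebra.norm K (f X - f Y)) =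
      c * algebraMap K L (Algebra.norm K (X - Y)) ^ m) :
    ∃ (a b : L) (i : ℕ), (∀ x, f x = a * x ^ p ^ i + b) ∧ ∀ x : K, x ^ m = x ^ p ^ i := by
  obtain ⟨r, rfl⟩ := exponent_eq_prime_pow hq hK hL hn hm0 hm f hc hf
  let φ : L ≃+* L := (iterateFrobeniusEquiv L p r).symm
  have hφ (x : L) : φ x ^ p ^ r = x := by
    rw [← iterateFrobenius_def, ← coe_iterateFrobeniusEquiv]
    exact (iterateFrobeniusEquiv L p r).apply_symm_apply x
  have hinj : Function.Injective fun x : L => x ^ p ^ r := fun x y h =>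
    iterateFrobenius_inj L p r (by simpa [iterateFrobenius_def] using h)
  have hnorm (x : L) : algebraMap K L (Algebra.norm K x) ^ p ^ r =
      algebraMap K L (Algebra.norm K (x ^ p ^ r)) := by rw [map_pow, map_pow]
  obtain ⟨a, b, i, hab⟩ := eq_frobenius_affine_of_norm_sub hq hK hL hn hq2
    (f.trans φ.toEquiv) (c := φ c) (by simpa using hc) (fun X Y => by
      apply hinj
      simp only [mul_pow, hφ]
      rw [← hf, hnorm, Equiv.trans_apply, Equiv.trans_apply, RingEquiv.toEquiv_eq_coe,
        EquivLike.coe_coe, ← map_sub, hφ])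
  refine ⟨a ^ p ^ r, b ^ p ^ r, k * i + r, fun x => ?_, fun x => ?_⟩
  · rw [← hφ (f x)]
    have : φ (f x) = a * x ^ q ^ i + b := hab x
    rw [this, add_pow_expChar_pow, mul_pow, hq, ← pow_mul, ← pow_mul, ← pow_add]
  · have : Finite K := Nat.finite_of_card_ne_zero (by omega)
    have := Fintype.ofFinite K
    rw [pow_add, pow_mul, pow_mul, ← hq, ← hK, Nat.card_eq_fintype_card, FiniteField.pow_card_pow]

end NormRigidity

section CommonNeighbors

variable {K L : Type*} [Field K] [Field L] [Algebra K L]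

theorem card_norm_fiber [Finite L] (z : Kˣ) :
    Nat.card {Y : L // Algebra.norm K Y = z} = Nat.card {Y : L // Algebra.norm K Y = 1} := by
  have : Finite K := Finite.of_injective _ (algebraMap K L).injective
  obtain ⟨W, hW⟩ := FiniteField.norm_surjective K L z
  have hW0 : W ≠ 0 := by
    rintro rfl
    rw [Algebra.norm_zero] at hW
    exact z.ne_zero hW.symm
  refine (Nat.card_congr ((Equiv.mulLeft₀ W hW0).subtypeEquiv fun Y => ?_)).symm
  simp [hW]

/-- The common neighbours of two vertices with distinct first coordinates. -/
noncomputable def commonNeighborsEquiv [Finite L] (u v : L × Kˣ) (h : u.1 ≠ v.1) :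
    {w : L × Kˣ // NormGraphAdj K L u w ∧ NormGraphAdj K L v w} ≃
      {Y : L // Y ≠ 1 ∧ Algebra.norm K Y = (u.2 / v.2 : Kˣ)} where
  toFun w := ⟨(u.1 + w.1.1) / (v.1 + w.1.1), by
    have h2 : v.1 + w.1.1 ≠ 0 := by
      intro h0
      have := w.2.2
      rw [NormGraphAdj, h0, Algebra.norm_zero] at this
      exact (v.2 * w.1.2).ne_zero this.symm
    refine ⟨fun h1 => h ?_, ?_⟩
    · rw [div_eq_one_iff_eq h2] at h1
      exact add_right_cancel h1
    · have e1 : Algebra.norm K (u.1 + w.1.1) = _ := w.2.1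
      have e2 : Algebra.norm K (v.1 + w.1.1) = _ := w.2.2
      have e3 := congrArg (Algebra.norm K) (div_mul_cancel₀ (u.1 + w.1.1) h2)
      rw [map_mul, e1, e2, ← mul_assoc] at e3
      rw [Units.val_div_eq_div_val, eq_div_iff v.2.ne_zero]
      exact mul_right_cancel₀ w.1.2.ne_zero e3⟩
  invFun Y := ⟨((u.1 - v.1 * Y.1) / (Y.1 - 1),
      unitNorm K (Units.mk0 ((u.1 - v.1) / (Y.1 - 1))
        (div_ne_zero (sub_ne_zero.mpr h) (sub_ne_zero.mpr Y.2.1))) / v.2), by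
    have hY : Y.1 - 1 ≠ 0 := sub_ne_zero.mpr Y.2.1
    have e1 : u.1 + (u.1 - v.1 * Y.1) / (Y.1 - 1) = Y.1 * ((u.1 - v.1) / (Y.1 - 1)) := by
      field_simp
      ring
    have e2 : v.1 + (u.1 - v.1 * Y.1) / (Y.1 - 1) = (u.1 - v.1) / (Y.1 - 1) := by
      field_simp
      ring
    have hv := v.2.ne_zero
    constructor
    · rw [NormGraphAdj]
      dsimp only
      refine Eq.trans ?_ (congrArg ((u.2 : K) * ·) (Units.val_div_eq_div_val _ _).symm)
      change _ = (u.2 : K) * (Algebra.norm K ((u.1 - v.1) / (Y.1 - 1)) / v.2)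
      rw [e1, map_mul, Y.2.2.trans (Units.val_div_eq_div_val _ _)]
      ring
    · rw [NormGraphAdj]
      dsimp only
      refine Eq.trans ?_ (congrArg ((v.2 : K) * ·) (Units.val_div_eq_div_val _ _).symm)
      change _ = (v.2 : K) * (Algebra.norm K ((u.1 - v.1) / (Y.1 - 1)) / v.2)
      rw [e2, mul_div_cancel₀ _ hv]⟩
  left_inv w := by
    have h2 : v.1 + w.1.1 ≠ 0 := by
      intro h0
      have := w.2.2
      rw [NormGraphAdj, h0, Algebra.norm_zero] at this
      exact (v.2 * w.1.2).ne_zero this.symm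
    have h3 : u.1 - v.1 ≠ 0 := sub_ne_zero.mpr h
    have e0 : (u.1 + w.1.1) / (v.1 + w.1.1) - 1 = (u.1 - v.1) / (v.1 + w.1.1) := by
      field_simp
      ring
    have e1 : (u.1 - v.1 * ((u.1 + w.1.1) / (v.1 + w.1.1))) /
        ((u.1 + w.1.1) / (v.1 + w.1.1) - 1) = w.1.1 := by
      rw [e0]
      field_simp
      ring
    have e2 : (u.1 - v.1) / ((u.1 + w.1.1) / (v.1 + w.1.1) - 1) = v.1 + w.1.1 := by
      rw [e0]
      field_simp
    refine Subtype.ext (Prod.ext e1 (Units.ext ?_))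
    rw [Units.val_div_eq_div_val]
    simp only [unitNorm, Units.coe_map, Units.val_mk0]
    rw [e2, w.2.2]
    exact mul_div_cancel_left₀ _ v.2.ne_zero
  right_inv Y := by
    have hY : Y.1 - 1 ≠ 0 := sub_ne_zero.mpr Y.2.1
    have h3 : u.1 - v.1 ≠ 0 := sub_ne_zero.mpr h
    apply Subtype.ext
    dsimp only
    have e1 : u.1 + (u.1 - v.1 * Y.1) / (Y.1 - 1) = Y.1 * ((u.1 - v.1) / (Y.1 - 1)) := by
      field_simp
      ring
    have e2 : v.1 + (u.1 - v.1 * Y.1) / (Y.1 - 1) = (u.1 - v.1) / (Y.1 - 1) := by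
      field_simp
      ring
    rw [e1, e2, mul_div_cancel_right₀ _ (div_ne_zero h3 hY)]

/-- Two distinct vertices differ in both coordinates iff their number of common neighbours is the
order of the kernel of the norm. -/
theorem card_commonNeighbors_eq_iff [Finite L] {u v : L × Kˣ} (huv : u ≠ v) :
    Nat.card {w : L × Kˣ // NormGraphAdj K L u w ∧ NormGraphAdj K L v w} =
      Nat.card {Y : L // Algebra.norm K Y = 1} ↔ u.1 ≠ v.1 ∧ u.2 ≠ v.2 := by
  have hpos : 0 < Nat.card {Y : L // Algebra.norm K Y = 1} :=
    Nat.card_pos_iff.mpr ⟨⟨⟨1, map_one _⟩⟩, inferInstance⟩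
  by_cases h1 : u.1 = v.1
  · have : IsEmpty {w : L × Kˣ // NormGraphAdj K L u w ∧ NormGraphAdj K L v w} := by
      refine ⟨fun w => huv (Prod.ext h1 (Units.ext ?_))⟩
      have e1 : Algebra.norm K (u.1 + w.1.1) = _ := w.2.1
      have e2 : Algebra.norm K (v.1 + w.1.1) = _ := w.2.2
      rw [h1, e2] at e1
      exact (mul_right_cancel₀ w.1.2.ne_zero e1).symm
    rw [Nat.card_of_isEmpty]
    constructor
    · intro h; omega
    · intro h; exact absurd h1 h.1
  · rw [Nat.card_congr (commonNeighborsEquiv u v h1)]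
    by_cases h2 : u.2 = v.2
    · have hlt : Nat.card {Y : L // Y ≠ 1 ∧ Algebra.norm K Y = (u.2 / v.2 : Kˣ)} <
          Nat.card {Y : L // Algebra.norm K Y = 1} := by
        rw [h2, div_self']
        change Nat.card ({Y : L | Y ≠ 1 ∧ Algebra.norm K Y = (1 : Kˣ)} : Set L) <
          Nat.card ({Y : L | Algebra.norm K Y = 1} : Set L)
        rw [Nat.card_coe_set_eq, Nat.card_coe_set_eq]
        refine Set.ncard_lt_ncard ?_ (Set.toFinite _)
        refine ⟨fun Y hY => by simpa using hY.2, fun h => ?_⟩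
        exact (h (show (1 : L) ∈ {Y : L | Algebra.norm K Y = 1} from map_one _)).1 rfl
      constructor
      · intro h; omega
      · intro h; exact absurd h2 h.2
    · refine ⟨fun _ => ⟨h1, h2⟩, fun _ => ?_⟩
      rw [← card_norm_fiber (u.2 / v.2)]
      refine Nat.card_congr (Equiv.subtypeEquivRight fun Y => ⟨fun h => h.2, fun h => ⟨?_, h⟩⟩)
      rintro rfl
      rw [map_one] at h
      exact h2 (div_eq_one.mp (Units.ext h.symm))

theorem NormGraphAut.rook_iff [Finite L] (Φ : NormGraphAut K L) {u v : L × Kˣ} (huv : u ≠ v) :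
    ((Φ u).1 ≠ (Φ v).1 ∧ (Φ u).2 ≠ (Φ v).2) ↔ (u.1 ≠ v.1 ∧ u.2 ≠ v.2) := by
  rw [← card_commonNeighbors_eq_iff huv, ← card_commonNeighbors_eq_iff (Φ.injective.ne huv)]
  rw [← Nat.card_congr (Φ.toEquiv.subtypeEquiv fun w => ?_)]
  exact and_congr Φ.map_rel_iff.symm Φ.map_rel_iff.symm

theorem NormGraphAut.snd_eq_of_snd_eq [Finite L] (Φ : NormGraphAut K L) {u v : L × Kˣ}
    (h : u.2 = v.2) : (Φ u).2 = (Φ v).2 := by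
  by_cases huv : u = v
  · rw [huv]
  by_contra h2
  have h1 : (Φ u).1 = (Φ v).1 := by
    by_contra h1
    exact ((Φ.rook_iff huv).mp ⟨h1, h2⟩).2 h
  have hcol (Z : L) : (Φ (Z, u.2)).1 = (Φ u).1 := by
    by_contra hZ
    have hZu : (Z, u.2) ≠ u := fun e => hZ (by rw [e])
    have hZv : (Z, u.2) ≠ v := fun e => hZ (by rw [e, h1])
    have e1 : (Φ (Z, u.2)).2 = (Φ u).2 := by
      by_contra e
      exact ((Φ.rook_iff hZu).mp ⟨hZ, e⟩).2 rfl
    have e2 : (Φ (Z, u.2)).2 = (Φ v).2 := by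
      by_contra e
      exact ((Φ.rook_iff hZv).mp ⟨h1 ▸ hZ, e⟩).2 h
    exact h2 (e1.symm.trans e2)
  have hinj : Function.Injective fun Z : L => ((Φ (Z, u.2)).2 : K) := by
    intro Z W hZW
    have := Φ.injective (Prod.ext ((hcol Z).trans (hcol W).symm) (Units.ext hZW))
    exact congrArg Prod.fst this
  have : Finite K := Finite.of_injective _ (algebraMap K L).injective
  have := Fintype.ofFinite K
  have := Fintype.ofFinite L
  have hsurj : Function.Surjective fun Z : L => ((Φ (Z, u.2)).2 : K) := by
    refine ((Fintype.bijective_iff_injective_and_card _).mpr ⟨hinj, le_antisymm ?_ ?_⟩).2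
    · exact Fintype.card_le_of_injective _ hinj
    · exact Fintype.card_le_of_injective _ (algebraMap K L).injective
  obtain ⟨Z, hZ⟩ := hsurj 0
  exact (Φ (Z, u.2)).2.ne_zero hZ

theorem NormGraphAut.snd_eq_iff [Finite L] (Φ : NormGraphAut K L) {u v : L × Kˣ} :
    (Φ u).2 = (Φ v).2 ↔ u.2 = v.2 := by
  refine ⟨fun h => ?_, Φ.snd_eq_of_snd_eq⟩
  simpa using NormGraphAut.snd_eq_of_snd_eq Φ.symm h

theorem NormGraphAut.fst_eq_of_fst_eq [Finite L] (Φ : NormGraphAut K L) {u v : L × Kˣ}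
    (h : u.1 = v.1) : (Φ u).1 = (Φ v).1 := by
  by_cases huv : u = v
  · rw [huv]
  by_contra h1
  have h2 : (Φ u).2 ≠ (Φ v).2 := fun h2 => huv (Prod.ext h (Φ.snd_eq_iff.mp h2))
  exact ((Φ.rook_iff huv).mp ⟨h1, h2⟩).1 h

/-- Every automorphism acts on the two coordinates separately. -/
theorem NormGraphAut.exists_prod [Finite L] (Φ : NormGraphAut K L) :
    ∃ (f : L ≃ L) (g : Kˣ ≃ Kˣ), ∀ X x, Φ (X, x) = (f X, g x) := by
  have : Finite K := Finite.of_injective _ (algebraMap K L).injective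
  have hf : Function.Injective fun X : L => (Φ (X, 1)).1 := fun X Y h => by
    have := NormGraphAut.fst_eq_of_fst_eq Φ.symm h
    simpa using this
  have hg : Function.Injective fun x : Kˣ => (Φ (0, x)).2 := fun x y h => Φ.snd_eq_iff.mp h
  refine ⟨Equiv.ofBijective _ (Finite.injective_iff_bijective.mp hf),
    Equiv.ofBijective _ (Finite.injective_iff_bijective.mp hg), fun X x => ?_⟩
  exact Prod.ext (Φ.fst_eq_of_fst_eq rfl) (Φ.snd_eq_of_snd_eq rfl)

end CommonNeighbors

section Classification

variable {K L : Type*} [Field K] [Field L] [Algebra K L]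

/-- If `(X, x) ↦ (f X, g x)` is an automorphism, then `g` is a constant times a power map, and `f`
transforms norms of differences by the corresponding power map. -/
theorem NormGraphAut.exists_exponent [Finite L] (Φ : NormGraphAut K L) {f : L ≃ L} {g : Kˣ ≃ Kˣ}
    (hΦ : ∀ X x, Φ (X, x) = (f X, g x)) :
    ∃ m : ℕ, 0 < m ∧ m < Nat.card K ∧ (∀ x, g x = g 1 * x ^ m) ∧ f 0 + f 0 = 0 ∧
      ∀ X Y, Algebra.norm K (f X - f Y) = (g 1 : K) ^ 2 * Algebra.norm K (X - Y) ^ m := by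
  have : Finite K := Finite.of_injective _ (algebraMap K L).injective
  have hadj (X Y : L) (x y : Kˣ) : Algebra.norm K (f X + f Y) = (g x : K) * g y ↔
      Algebra.norm K (X + Y) = (x : K) * y := by
    have := Φ.map_rel_iff (a := (X, x)) (b := (Y, y))
    rwa [hΦ, hΦ] at this
  have hmul (x y : Kˣ) : g (x * y) * g 1 = g x * g y := by
    obtain ⟨X, hX⟩ := FiniteField.norm_surjective K L ((x * y : Kˣ) : K)
    have e1 := (hadj X 0 (x * y) 1).mpr (by simp [hX])
    have e2 := (hadj X 0 x y).mpr (by simp [hX])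
    exact Units.ext (by simpa using e1.symm.trans e2)
  let h : Kˣ →* Kˣ :=
    { toFun := fun x => g x / g 1
      map_one' := div_self' _
      map_mul' := fun x y => by
        rw [div_eq_iff_eq_mul, div_mul_div_comm, ← hmul]
        simp [mul_div_assoc] }
  obtain ⟨M, hM⟩ := h.map_cyclic
  have hcard : 2 ≤ Nat.card K := Finite.one_lt_card
  set N : ℕ := Nat.card K - 1 with hN
  have hNpos : (0 : ℤ) < N := by omega
  set m : ℕ := ((M - 1) % N).toNat + 1 with hm
  have hm1 := Int.emod_nonneg (M - 1) hNpos.ne'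
  have hm2 := Int.emod_lt_of_pos (M - 1) hNpos
  have hord (x : Kˣ) : x ^ (N : ℤ) = 1 := by
    rw [zpow_natCast, hN, ← Nat.card_units, pow_card_eq_one']
  have hpow (x : Kˣ) : x ^ M = x ^ m := by
    have hMm : M = (m : ℤ) + N * ((M - 1) / N) := by
      have := Int.emod_add_mul_ediv (M - 1) N
      omega
    calc x ^ M = x ^ ((m : ℤ) + N * ((M - 1) / N)) := congrArg (x ^ ·) hMm
      _ = x ^ m := by rw [zpow_add, zpow_mul, hord, one_zpow, mul_one, zpow_natCast]
  have hg (x : Kˣ) : g x = g 1 * x ^ m := by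
    rw [← hpow, ← hM]
    exact (mul_div_cancel _ _).symm
  have hzero (X Y : L) (hXY : X + Y = 0) : f X + f Y = 0 := by
    by_contra hne
    have hz : Algebra.norm K (f X + f Y) ≠ 0 := Algebra.norm_ne_zero_iff.mpr hne
    obtain ⟨y, hy⟩ := g.surjective (Units.mk0 _ hz / g 1)
    have := (hadj X Y 1 y).mp (by rw [hy, ← Units.val_mul, mul_div_cancel, Units.val_mk0])
    rw [hXY, Algebra.norm_zero] at this
    exact (1 * y).ne_zero this.symm
  have hadd (X Y : L) :
      Algebra.norm K (f X + f Y) = (g 1 : K) ^ 2 * Algebra.norm K (X + Y) ^ m := by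
    by_cases hXY : X + Y = 0
    · rw [hXY, hzero X Y hXY, Algebra.norm_zero, zero_pow (by omega), mul_zero]
    · have hz : Algebra.norm K (X + Y) ≠ 0 := Algebra.norm_ne_zero_iff.mpr hXY
      rw [(hadj X Y (Units.mk0 _ hz) 1).mpr (by simp), hg]
      simp only [Units.val_mul, Units.val_pow_eq_pow_val, Units.val_mk0]
      ring
  refine ⟨m, by omega, by omega, hg, hzero 0 0 (add_zero 0), fun X Y => ?_⟩
  have hneg : f (-Y) = -f Y := eq_neg_of_add_eq_zero_left (hzero _ _ (neg_add_cancel Y))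
  rw [sub_eq_add_neg, ← hneg, hadd, sub_eq_add_neg]

variable {p k q n : ℕ} [Fact p.Prime] [CharP L p] [Finite L]

/-- For `q > 2`, every automorphism is affine over a power of the Frobenius. -/
theorem NormGraphAut.exists_affine (hq : q = p ^ k) (hK : Nat.card K = q)
    (hL : Module.finrank K L = n) (hn : n ≠ 0) (hq2 : 2 < q) (Φ : NormGraphAut K L) :
    ∃ (a : Lˣ) (γ : Kˣ) (b : L) (i : ℕ), Algebra.norm K (a : L) = (γ : K) ^ 2 ∧ b + b = 0 ∧
      ∀ X x, Φ (X, x) = (a * X ^ p ^ i + b, γ * x ^ p ^ i) := by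
  obtain ⟨f, g, hΦ⟩ := Φ.exists_prod
  obtain ⟨m, hm0, hm, hg, hf0, hf⟩ := Φ.exists_exponent hΦ
  have hc : algebraMap K L ((g 1 : K) ^ 2) ≠ 0 := by simp
  obtain ⟨a, b, i, hab, hmi⟩ := eq_frobenius_affine_of_norm_sub_pow hq hK hL hn hq2 hm0
    (by omega) f hc (fun X Y => by rw [hf, map_mul, map_pow (algebraMap K L) (Algebra.norm K _)])
  have hp0 : p ^ i ≠ 0 := pow_ne_zero _ (Fact.out : p.Prime).ne_zero
  have hb : f 0 = b := by rw [hab, zero_pow hp0, mul_zero, zero_add]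
  have ha : Algebra.norm K a = (g 1 : K) ^ 2 := by
    have := hf 1 0
    rw [hab, hab, zero_pow hp0] at this
    simpa using this
  have ha0 : a ≠ 0 := by
    rintro rfl
    rw [Algebra.norm_zero] at ha
    exact pow_ne_zero 2 (g 1).ne_zero ha.symm
  refine ⟨Units.mk0 a ha0, g 1, b, i, ha, by rwa [hb] at hf0, fun X x => ?_⟩
  rw [hΦ, hab, hg]
  refine Prod.ext rfl (Units.ext ?_)
  simp [hmi]

end Classification

section InternalSemidirect

variable {A B C G : Type*} [Group A] [Group B] [Group C] [Group G]

/-- Two embedded subgroups with trivial intersection, the second normalizing the first, embed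
their semidirect product. -/
theorem SemidirectProduct.exists_injective_hom (ι : A →* G) (κ : B →* G)
    (hι : Function.Injective ι) (hκ : Function.Injective κ)
    (hdisj : ∀ a b, ι a = κ b → ι a = 1)
    (hnorm : ∀ b a, ∃ a', κ b * ι a = ι a' * κ b) :
    ∃ (φ : B →* MulAut A) (F : A ⋊[φ] B →* G), Function.Injective F ∧
      ∀ x, F x = ι x.left * κ x.right := by
  choose act hact using hnorm
  have hone (a : A) : act 1 a = a := hι (by simpa using (hact 1 a).symm)
  have hcomp (b b' : B) (a : A) : act (b * b') a = act b (act b' a) := by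
    apply hι
    apply mul_right_cancel (b := κ (b * b'))
    rw [← hact, map_mul, mul_assoc, hact b' a, ← mul_assoc, hact b, mul_assoc]
  have hmul (b : B) (a a' : A) : act b (a * a') = act b a * act b a' := by
    apply hι
    apply mul_right_cancel (b := κ b)
    rw [← hact, map_mul, map_mul, ← mul_assoc, hact b a, mul_assoc, hact b a', mul_assoc]
  let φ : B →* MulAut A :=
    { toFun := fun b =>
        { toFun := act b
          invFun := act b⁻¹
          left_inv := fun a => by rw [← hcomp, inv_mul_cancel, hone]
          right_inv := fun a => by rw [← hcomp, mul_inv_cancel, hone]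
          map_mul' := hmul b }
      map_one' := MulEquiv.ext hone
      map_mul' := fun b b' => MulEquiv.ext (hcomp b b') }
  have hF (x : A ⋊[φ] B) : SemidirectProduct.lift ι κ (fun b => MonoidHom.ext fun a => by
      simpa [φ, eq_mul_inv_iff_mul_eq] using (hact b a).symm) x = ι x.left * κ x.right := rfl
  refine ⟨φ, _, (injective_iff_map_eq_one _).mpr fun x hx => ?_, hF⟩
  rw [hF] at hx
  have h1 : ι x.left = κ x.right⁻¹ := by rw [map_inv]; exact eq_inv_of_mul_eq_one_left hx
  have h2 := hdisj _ _ h1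
  rw [h2, one_mul] at hx
  exact SemidirectProduct.ext (hι (h2.trans (map_one ι).symm)) (hκ (hx.trans (map_one κ).symm))

/-- Recognition of an internal semidirect product. -/
theorem SemidirectProduct.exists_mulEquiv (ι : A →* G) (κ : B →* G)
    (hι : Function.Injective ι) (hκ : Function.Injective κ)
    (hdisj : ∀ a b, ι a = κ b → ι a = 1)
    (hnorm : ∀ b a, ∃ a', κ b * ι a = ι a' * κ b) (hgen : ∀ g, ∃ a b, g = ι a * κ b) :
    ∃ φ : B →* MulAut A, Nonempty (G ≃* A ⋊[φ] B) := by
  obtain ⟨φ, F, hF, hF'⟩ := SemidirectProduct.exists_injective_hom ι κ hι hκ hdisj hnorm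
  refine ⟨φ, ⟨(MulEquiv.ofBijective F ⟨hF, fun g => ?_⟩).symm⟩⟩
  obtain ⟨a, b, rfl⟩ := hgen g
  exact ⟨⟨a, b⟩, hF' _⟩

/-- Recognition of an internal semidirect product with three factors. -/
theorem SemidirectProduct.exists_mulEquiv_triple (ι : A →* G) (κ : B →* G) (μ : C →* G)
    (hι : Function.Injective ι) (hκ : Function.Injective κ) (hμ : Function.Injective μ)
    (hικ : ∀ a b, ι a = κ b → ι a = 1)
    (hικμ : ∀ a b c, ι a * κ b = μ c → ι a * κ b = 1)
    (hκι : ∀ b a, ∃ a', κ b * ι a = ι a' * κ b)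
    (hμι : ∀ c a, ∃ a', μ c * ι a = ι a' * μ c)
    (hμκ : ∀ c b, ∃ b', μ c * κ b = κ b' * μ c)
    (hgen : ∀ g, ∃ a b c, g = ι a * κ b * μ c) :
    ∃ (ψ : B →* MulAut A) (φ : C →* MulAut (A ⋊[ψ] B)), Nonempty (G ≃* (A ⋊[ψ] B) ⋊[φ] C) := by
  obtain ⟨ψ, F, hF, hF'⟩ := SemidirectProduct.exists_injective_hom ι κ hι hκ hικ hκι
  refine ⟨ψ, SemidirectProduct.exists_mulEquiv F μ hF hμ (fun x c h => ?_) (fun c x => ?_)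
    (fun g => ?_)⟩
  · rw [hF'] at h ⊢
    exact hικμ _ _ _ h
  · obtain ⟨a', ha'⟩ := hμι c x.left
    obtain ⟨b', hb'⟩ := hμκ c x.right
    refine ⟨⟨a', b'⟩, ?_⟩
    rw [hF', hF', ← mul_assoc, ha', mul_assoc, hb', mul_assoc]
  · obtain ⟨a, b, c, rfl⟩ := hgen g
    exact ⟨⟨a, b⟩, c, by rw [hF']⟩

theorem nonempty_cyc_mulEquiv [IsCyclic G] {n : ℕ} (h : Nat.card G = n) :
    Nonempty (Cyc n ≃* G) := by
  subst h
  exact ⟨zmodCyclicMulEquiv inferInstance⟩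

end InternalSemidirect

section NormGraphMaps

variable (K L : Type*) [Field K] [Field L] [Algebra K L]

/-- The pairs `(a, γ)` with `N(a) = γ ^ 2`; these are the multipliers of the linear automorphisms
`(X, x) ↦ (a * X, γ * x)` of the projective norm graph. -/
noncomputable def normSqPairs : Subgroup (Lˣ × Kˣ) where
  carrier := {u | unitNorm K u.1 = u.2 ^ 2}
  one_mem' := by simp [unitNorm]
  mul_mem' {u v} hu hv := by
    simp only [Set.mem_ofPred_eq, unitNorm, Prod.fst_mul, Prod.snd_mul, map_mul, mul_pow] at *
    rw [hu, hv]
  inv_mem' {u} hu := by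
    simp only [Set.mem_ofPred_eq, unitNorm, Prod.fst_inv, Prod.snd_inv, map_inv, inv_pow] at *
    rw [hu]

variable {K L}

theorem mem_normSqPairs {u : Lˣ × Kˣ} :
    u ∈ normSqPairs K L ↔ Algebra.norm K (u.1 : L) = (u.2 : K) ^ 2 := by
  change unitNorm K u.1 = u.2 ^ 2 ↔ _
  rw [Units.ext_iff]
  rfl

theorem unitNorm_mul (C D : Lˣ) : unitNorm K (C * D) = unitNorm K C * unitNorm K D :=
  map_mul _ _ _

/-- The multipliers `(C ^ 2, N(C))`. -/
noncomputable def sqNorm : Lˣ →* normSqPairs K L where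
  toFun C := ⟨(C ^ 2, unitNorm K C), by
    change unitNorm K (C ^ 2) = unitNorm K C ^ 2
    rw [unitNorm, map_pow]; rfl⟩
  map_one' := by ext <;> simp [unitNorm]
  map_mul' C D := by ext <;> simp [unitNorm, mul_pow]

variable {p : ℕ} [Fact p.Prime] [CharP L p] [Finite L]

/-- The automorphism `(X, x) ↦ (a * X ^ p ^ i + b, γ * x ^ p ^ i)` of the projective norm graph,
for `N(a) = γ ^ 2` and `2 * b = 0`. -/
noncomputable def affineAut (p : ℕ) [Fact p.Prime] [CharP L p] (u : normSqPairs K L) (b : L)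
    (hb : b + b = 0) (i : ℕ) : NormGraphAut K L where
  toEquiv := Equiv.ofBijective
    (fun v : L × Kˣ => ((u.1.1 : L) * v.1 ^ p ^ i + b, u.1.2 * v.2 ^ p ^ i)) <| by
      have : Finite K := Finite.of_injective _ (algebraMap K L).injective
      have : CharP K p := (algebraMap K L).charP (algebraMap K L).injective p
      refine Finite.injective_iff_bijective.mp fun v w h => ?_
      rw [Prod.mk.injEq] at h
      refine Prod.ext ?_ (Units.ext ?_)
      · exact iterateFrobenius_inj L p i (by simpa [iterateFrobenius_def] using h.1)
      · have := congrArg (Units.val) (mul_left_cancel h.2)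
        exact iterateFrobenius_inj K p i (by simpa [iterateFrobenius_def] using this)
  map_rel_iff' {v w} := by
    have : CharP K p := (algebraMap K L).charP (algebraMap K L).injective p
    have hsum : (u.1.1 : L) * v.1 ^ p ^ i + b + (u.1.1 * w.1 ^ p ^ i + b) =
        u.1.1 * (v.1 + w.1) ^ p ^ i := by
      rw [add_pow_expChar_pow]
      linear_combination hb
    change Algebra.norm K ((u.1.1 : L) * v.1 ^ p ^ i + b + (u.1.1 * w.1 ^ p ^ i + b)) =
      ((u.1.2 * v.2 ^ p ^ i : Kˣ) : K) * ((u.1.2 * w.2 ^ p ^ i : Kˣ) : K) ↔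
      Algebra.norm K (v.1 + w.1) = (v.2 : K) * w.2
    rw [hsum, map_mul, map_pow, mem_normSqPairs.mp u.2]
    have hprod : ((u.1.2 * v.2 ^ p ^ i : Kˣ) : K) * ((u.1.2 * w.2 ^ p ^ i : Kˣ) : K) =
        (u.1.2 : K) ^ 2 * ((v.2 : K) * w.2) ^ p ^ i := by
      push_cast
      ring
    rw [hprod, mul_right_inj' (pow_ne_zero 2 u.1.2.ne_zero), ← iterateFrobenius_def,
      ← iterateFrobenius_def, (iterateFrobenius_inj K p i).eq_iff]

theorem affineAut_apply (u : normSqPairs K L) (b : L) (hb : b + b = 0) (i : ℕ) (X : L) (x : Kˣ) :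
    affineAut p u b hb i (X, x) = ((u.1.1 : L) * X ^ p ^ i + b, u.1.2 * x ^ p ^ i) := rfl

/-- The linear automorphisms. -/
noncomputable def linearAut (K L : Type*) [Field K] [Field L] [Algebra K L] [Finite L] (p : ℕ)
    [Fact p.Prime] [CharP L p] : normSqPairs K L →* NormGraphAut K L where
  toFun u := affineAut p u 0 (add_zero 0) 0
  map_one' := by
    ext v <;> simp [affineAut]
  map_mul' u v := by
    apply RelIso.ext
    rintro ⟨X, x⟩
    rw [RelIso.mul_apply]
    simp [affineAut_apply, mul_assoc]

theorem linearAut_apply (u : normSqPairs K L) (X : L) (x : Kˣ) :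
    linearAut K L p u (X, x) = ((u.1.1 : L) * X, u.1.2 * x) := by
  simp [linearAut, affineAut_apply]

theorem linearAut_injective : Function.Injective (linearAut K L p) := by
  intro u v h
  have := congrArg (fun Φ : NormGraphAut K L => Φ (1, 1)) h
  simp only [linearAut_apply, mul_one, Prod.mk.injEq] at this
  exact Subtype.ext (Prod.ext (Units.ext this.1) this.2)

/-- The translations in characteristic two. -/
noncomputable def translationAut (K L : Type*) [Field K] [Field L] [Algebra K L] [Finite L]
    [CharP L 2] : Multiplicative L →* NormGraphAut K L where
  toFun b := affineAut 2 1 b.toAdd (CharTwo.add_self_eq_zero _) 0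
  map_one' := by
    ext v <;> simp [affineAut]
  map_mul' b c := by
    apply RelIso.ext
    rintro ⟨X, x⟩
    rw [RelIso.mul_apply]
    simp [affineAut_apply, add_left_comm, add_comm]

theorem translationAut_apply [CharP L 2] (b : Multiplicative L) (X : L) (x : Kˣ) :
    translationAut K L b (X, x) = (X + b.toAdd, x) := by
  simp [translationAut, affineAut_apply]

theorem translationAut_injective [CharP L 2] : Function.Injective (translationAut K L) := by
  intro b c h
  have := congrArg (fun Φ : NormGraphAut K L => Φ (0, 1)) h
  simpa [translationAut_apply] using this

/-- The Frobenius automorphism `(X, x) ↦ (X ^ p, x ^ p)`. -/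
noncomputable def frobeniusAut (K L : Type*) [Field K] [Field L] [Algebra K L] [Finite L] (p : ℕ)
    [Fact p.Prime] [CharP L p] : NormGraphAut K L :=
  affineAut p 1 0 (add_zero 0) 1

theorem frobeniusAut_pow_apply (i : ℕ) (X : L) (x : Kˣ) :
    (frobeniusAut K L p ^ i) (X, x) = (X ^ p ^ i, x ^ p ^ i) := by
  induction i with
  | zero => simp
  | succ i ih =>
    rw [pow_succ', RelIso.mul_apply, ih]
    simp [frobeniusAut, affineAut_apply, pow_succ, pow_mul]

theorem orderOf_frobeniusAut {d : ℕ} (hQ : Nat.card L = p ^ d) :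
    orderOf (frobeniusAut K L p) = d := by
  have hp1 : 1 < p := (Fact.out : p.Prime).one_lt
  have hfin : Finite K := Finite.of_injective _ (algebraMap K L).injective
  have hL1 : 1 < Nat.card L := Finite.one_lt_card
  have hd : 0 < d := by
    by_contra h
    rw [hQ, Nat.eq_zero_of_not_pos h, pow_zero] at hL1
    omega
  rw [orderOf_eq_iff hd]
  have hpow (X : L) : X ^ p ^ d = X := by
    have := Fintype.ofFinite L
    rw [← hQ, Nat.card_eq_fintype_card, FiniteField.pow_card]
  constructor
  · apply RelIso.ext
    rintro ⟨X, x⟩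
    rw [frobeniusAut_pow_apply]
    refine Prod.ext (hpow X) (Units.ext ((algebraMap K L).injective ?_))
    simp [hpow]
  · intro m hm hm0 h
    have hlt : p ^ m < Nat.card L := by rw [hQ]; exact Nat.pow_lt_pow_right hp1 hm
    have heq := (linearIndependent_pow_fun (L := L)).injective
      (a₁ := ⟨p ^ m, hlt⟩) (a₂ := ⟨1, hL1⟩) (by
        funext X
        have := congrArg (fun Φ : NormGraphAut K L => (Φ (X, 1)).1) h
        simpa [frobeniusAut_pow_apply] using this)
    have : p ^ m = 1 := congrArg Fin.val heq
    have := Nat.one_lt_pow hm0.ne' hp1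
    omega

end NormGraphMaps

section Multipliers

variable {K L : Type*} [Field K] [Field L] [Algebra K L] [Finite L]

/-- If `N(a)` is the square of `γ`, then `a = C ^ 2` and `γ = ± N(C)` for some `C`. -/
theorem exists_sq_of_mem_normSqPairs {u : Lˣ × Kˣ} (hu : u ∈ normSqPairs K L) :
    ∃ C : Lˣ, u.1 = C ^ 2 ∧ (u.2 = unitNorm K C ∨ u.2 = -unitNorm K C) := by
  have : Finite K := Finite.of_injective _ (algebraMap K L).injective
  have := Fintype.ofFinite K
  have := Fintype.ofFinite L
  have hu' : unitNorm K u.1 = u.2 ^ 2 := hu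
  suffices h : ∃ C : Lˣ, u.1 = C ^ 2 by
    obtain ⟨C, hC⟩ := h
    refine ⟨C, hC, ?_⟩
    have h1 : unitNorm K u.1 = unitNorm K C ^ 2 := by rw [hC, unitNorm, map_pow]; rfl
    rw [hu'] at h1
    have h2 := congrArg Units.val h1
    rw [Units.val_pow_eq_pow_val, Units.val_pow_eq_pow_val, sq_eq_sq_iff_eq_or_eq_neg] at h2
    exact h2.imp (fun h => Units.ext h) (fun h => Units.ext (by simpa using h))
  by_cases hchar : ringChar K = 2
  · have hcharL : ringChar L = 2 := by
      rw [← Algebra.ringChar_eq K L, hchar]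
    obtain ⟨c, hc⟩ := FiniteField.isSquare_of_char_two hcharL (u.1 : L)
    have hc0 : c ≠ 0 := by
      rintro rfl
      simp at hc
    exact ⟨Units.mk0 c hc0, Units.ext (by simpa [sq] using hc)⟩
  · obtain ⟨ω, hω⟩ := IsCyclic.exists_generator (α := Lˣ)
    obtain ⟨l, hl⟩ := Subgroup.mem_zpowers_iff.mp (hω u.1)
    rcases Int.even_or_odd' l with ⟨j, rfl | rfl⟩
    · exact ⟨ω ^ j, by rw [← hl, mul_comm, zpow_mul]; rfl⟩
    · exfalso
      have hsq : IsSquare (unitNorm K ω) := by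
        have h1 : unitNorm K ω * (unitNorm K ω ^ j) ^ 2 = u.2 ^ 2 := by
          rw [← hu', ← hl, unitNorm, unitNorm, map_zpow, zpow_add_one, mul_comm (2 : ℤ),
            zpow_mul, mul_comm]
          rfl
        exact ⟨u.2 / unitNorm K ω ^ j, by rw [← sq, div_pow, ← h1, mul_div_cancel_right]⟩
      obtain ⟨a, ha⟩ := FiniteField.exists_nonsquare hchar
      have ha0 : a ≠ 0 := by
        rintro rfl
        exact ha (IsSquare.zero)
      obtain ⟨c, hc⟩ := FiniteField.unitsMap_norm_surjective K L (Units.mk0 a ha0)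
      obtain ⟨i, hi⟩ := Subgroup.mem_zpowers_iff.mp (hω c)
      apply ha
      have h2 : IsSquare (Units.mk0 a ha0) := by
        rw [← hc, ← hi, map_zpow]
        exact hsq.zpow i
      simpa using h2.map (Units.coeHom K)

theorem neg_one_ne_one_of_odd_card {F : Type*} [Field F] [Finite F] (h : Odd (Nat.card F)) :
    (-1 : Fˣ) ≠ 1 := by
  have := Fintype.ofFinite F
  intro h1
  refine Ring.neg_one_ne_one_of_char_ne_two (R := F) (fun h2 => ?_) (by
    simpa using congrArg Units.val h1)
  have := FiniteField.even_card_of_char_two h2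
  rw [Nat.card_eq_fintype_card, Nat.odd_iff] at h
  omega

theorem unitNorm_neg_one : unitNorm K (-1 : Lˣ) = (-1) ^ Module.finrank K L := by
  apply Units.ext
  have h : (-1 : L) = algebraMap K L (-1) := by simp
  change Algebra.norm K (-1 : L) = (-1) ^ _
  rw [h, Algebra.norm_algebraMap]

theorem eq_one_or_eq_neg_one_of_sq {F : Type*} [Field F] {C : Fˣ} (h : C ^ 2 = 1) :
    C = 1 ∨ C = -1 := by
  have h3 : (C : F) ^ 2 = 1 ^ 2 := by rw [← Units.val_pow_eq_pow_val, h, Units.val_one, one_pow]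
  exact (sq_eq_sq_iff_eq_or_eq_neg.mp h3).imp (fun h => Units.ext h)
    (fun h => Units.ext (by simpa using h))

/-- For odd `|K|` and odd degree, the linear automorphisms form a group isomorphic to `Lˣ`. -/
theorem sqNorm_bijective_of_odd (hK : Odd (Nat.card K)) (hn : Odd (Module.finrank K L)) :
    Function.Bijective (sqNorm (K := K) (L := L)) := by
  have : Finite K := Finite.of_injective _ (algebraMap K L).injective
  have hneg : unitNorm K (-1 : Lˣ) = -1 := by rw [unitNorm_neg_one, hn.neg_one_pow]
  constructor
  · refine (injective_iff_map_eq_one _).mpr fun C hC => ?_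
    have h1 : C ^ 2 = 1 := congrArg (fun u => u.1.1) hC
    have h2 : unitNorm K C = 1 := congrArg (fun u => u.1.2) hC
    refine (eq_one_or_eq_neg_one_of_sq h1).resolve_right fun h => ?_
    rw [h, hneg] at h2
    exact neg_one_ne_one_of_odd_card hK h2
  · rintro ⟨u, hu⟩
    obtain ⟨C, hC, h | h⟩ := exists_sq_of_mem_normSqPairs hu
    · exact ⟨C, Subtype.ext (Prod.ext hC.symm h.symm)⟩
    · refine ⟨-1 * C, Subtype.ext (Prod.ext ?_ ?_)⟩
      · change (-1 * C) ^ 2 = u.1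
        rw [hC]; simp
      · change unitNorm K (-1 * C) = u.2
        rw [h, unitNorm_mul, hneg, neg_one_mul]

/-- In characteristic two, the linear automorphisms form a group isomorphic to `Lˣ`. -/
theorem sqNorm_bijective_of_char_two [CharP L 2] :
    Function.Bijective (sqNorm (K := K) (L := L)) := by
  have : CharP K 2 := (algebraMap K L).charP (algebraMap K L).injective 2
  constructor
  · refine (injective_iff_map_eq_one _).mpr fun C hC => ?_
    have h1 : C ^ 2 = 1 := congrArg (fun u => u.1.1) hC
    have h2 : (-1 : Lˣ) = 1 := Units.ext (by simp [CharTwo.neg_eq])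
    simpa [h2] using eq_one_or_eq_neg_one_of_sq h1
  · rintro ⟨u, hu⟩
    obtain ⟨C, hC, h⟩ := exists_sq_of_mem_normSqPairs hu
    have h2 : -unitNorm K C = unitNorm K C := Units.ext (by simp [CharTwo.neg_eq])
    rw [h2, or_self] at h
    exact ⟨C, Subtype.ext (Prod.ext hC.symm h.symm)⟩

/-- For odd `|K|` and even degree, the linear automorphisms form a group isomorphic to the product
of a group of order two and a cyclic group of order `(|L| - 1) / 2`. -/
theorem nonempty_normSqPairs_mulEquiv (hK : Odd (Nat.card K)) (hn : Even (Module.finrank K L)) :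
    Nonempty (Cyc 2 × Cyc ((Nat.card L - 1) / 2) ≃* normSqPairs K L) := by
  have : Finite K := Finite.of_injective _ (algebraMap K L).injective
  have hL : Odd (Nat.card L) := by
    rw [Module.natCard_eq_pow_finrank (K := K)]
    exact hK.pow
  have hneg : unitNorm K (-1 : Lˣ) = 1 := by rw [unitNorm_neg_one, hn.neg_one_pow]
  let z : normSqPairs K L := ⟨(1, -1), by
    change unitNorm K 1 = (-1) ^ 2
    simp [unitNorm]⟩
  have hz2 : z ^ 2 = 1 := Subtype.ext (Prod.ext (one_pow 2) (by simp [z]))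
  have hz1 : z ≠ 1 := fun h => neg_one_ne_one_of_odd_card hK (congrArg (fun u => u.1.2) h)
  have hzpow (w : normSqPairs K L) (hw : w ∈ Subgroup.zpowers z) : w = 1 ∨ w = z := by
    obtain ⟨i, rfl⟩ := Subgroup.mem_zpowers_iff.mp hw
    rcases Int.even_or_odd' i with ⟨j, rfl | rfl⟩
    · left
      rw [zpow_mul]
      simp [hz2]
    · right
      rw [zpow_add_one, zpow_mul]
      simp [hz2]
  have hcardz : Nat.card (Subgroup.zpowers z) = 2 := by
    rw [Nat.card_zpowers, orderOf_eq_prime hz2 hz1]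
  have hker : (sqNorm (K := K) (L := L)).ker = Subgroup.zpowers (-1) := by
    ext C
    constructor
    · intro hC
      have h1 : C ^ 2 = 1 := congrArg (fun u => u.1.1) hC
      rcases eq_one_or_eq_neg_one_of_sq h1 with rfl | rfl
      · exact Subgroup.one_mem _
      · exact Subgroup.mem_zpowers _
    · intro hC
      refine (Subgroup.zpowers_le.mpr ?_) hC
      refine Subtype.ext (Prod.ext ?_ hneg)
      change (-1 : Lˣ) ^ 2 = 1
      simp
  have hcard : Nat.card (sqNorm (K := K) (L := L)).range = (Nat.card L - 1) / 2 := by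
    have h := Subgroup.card_mul_index (sqNorm (K := K) (L := L)).ker
    rw [Subgroup.index_ker, hker, Nat.card_zpowers,
      orderOf_eq_prime neg_one_sq (neg_one_ne_one_of_odd_card hL), Nat.card_units] at h
    omega
  have : IsCyclic (sqNorm (K := K) (L := L)).range :=
    isCyclic_of_surjective _ (sqNorm (K := K) (L := L)).rangeRestrict_surjective
  obtain ⟨e⟩ := nonempty_cyc_mulEquiv hcardz
  obtain ⟨e'⟩ := nonempty_cyc_mulEquiv hcard
  refine ⟨MulEquiv.ofBijective (((Subgroup.zpowers z).subtype.comp e.toMonoidHom).coprod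
    ((sqNorm (K := K) (L := L)).range.subtype.comp e'.toMonoidHom)) ⟨?_, ?_⟩⟩
  · refine (injective_iff_map_eq_one _).mpr ?_
    rintro ⟨i, j⟩ hij
    have hij' : (e i : normSqPairs K L) * (e' j : normSqPairs K L) = 1 := hij
    have hone : (e i : normSqPairs K L) = 1 := by
      refine (hzpow _ (e i).2).resolve_right fun h => ?_
      obtain ⟨C, hC⟩ := (e' j).2
      rw [h, ← hC] at hij'
      have h1 : 1 * C ^ 2 = 1 := congrArg (fun u => u.1.1) hij'
      have h2 : -1 * unitNorm K C = 1 := congrArg (fun u => u.1.2) hij'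
      have h3 : unitNorm K C = 1 := by
        rcases eq_one_or_eq_neg_one_of_sq (by simpa using h1) with rfl | rfl
        · exact map_one _
        · exact hneg
      rw [h3, mul_one] at h2
      exact neg_one_ne_one_of_odd_card hK h2
    rw [hone, one_mul] at hij'
    refine Prod.ext ?_ ?_
    · exact (map_eq_one_iff e e.injective).mp (Subtype.ext hone)
    · exact (map_eq_one_iff e' e'.injective).mp (Subtype.ext hij')
  · rintro ⟨u, hu⟩
    obtain ⟨C, hC, h⟩ := exists_sq_of_mem_normSqPairs hu
    obtain ⟨j, hj⟩ := e'.surjective ⟨sqNorm C, C, rfl⟩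
    rcases h with h | h
    · refine ⟨(1, j), ?_⟩
      change (e 1 : normSqPairs K L) * (e' j : normSqPairs K L) = _
      rw [hj, map_one, Subgroup.coe_one, one_mul]
      exact Subtype.ext (Prod.ext hC.symm h.symm)
    · obtain ⟨i, hi⟩ := e.surjective ⟨z, Subgroup.mem_zpowers z⟩
      refine ⟨(i, j), ?_⟩
      change (e i : normSqPairs K L) * (e' j : normSqPairs K L) = _
      rw [hj, hi]
      refine Subtype.ext (Prod.ext ?_ ?_)
      · change 1 * C ^ 2 = u.1
        rw [hC, one_mul]
      · change -1 * unitNorm K C = u.2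
        rw [h, neg_one_mul]

end Multipliers

section Structure

variable {K L : Type*} [Field K] [Field L] [Algebra K L] [Finite L]
variable {p k q n d : ℕ} [Fact p.Prime] [CharP L p]

theorem frobeniusAut_pow_mul_linearAut (i : ℕ) (u : normSqPairs K L) :
    frobeniusAut K L p ^ i * linearAut K L p u =
      linearAut K L p (u ^ p ^ i) * frobeniusAut K L p ^ i := by
  apply RelIso.ext
  rintro ⟨X, x⟩
  simp [RelIso.mul_apply, linearAut_apply, frobeniusAut_pow_apply, mul_pow, -map_pow]

theorem frobeniusAut_pow_mul_translationAut [CharP L 2] (i : ℕ) (b : Multiplicative L) :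
    frobeniusAut K L 2 ^ i * translationAut K L b =
      translationAut K L (Multiplicative.ofAdd (b.toAdd ^ 2 ^ i)) * frobeniusAut K L 2 ^ i := by
  apply RelIso.ext
  rintro ⟨X, x⟩
  simp [RelIso.mul_apply, translationAut_apply, frobeniusAut_pow_apply, add_pow_expChar_pow]

theorem linearAut_mul_translationAut [CharP L 2] (u : normSqPairs K L) (b : Multiplicative L) :
    linearAut K L 2 u * translationAut K L b =
      translationAut K L (Multiplicative.ofAdd (u.1.1 * b.toAdd)) * linearAut K L 2 u := by
  apply RelIso.ext
  rintro ⟨X, x⟩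
  simp [RelIso.mul_apply, translationAut_apply, linearAut_apply, mul_add]

theorem linearAut_eq_one_of_eq_frobeniusAut_pow {u : normSqPairs K L} {i : ℕ}
    (h : linearAut K L p u = frobeniusAut K L p ^ i) : linearAut K L p u = 1 := by
  have := congrArg (fun Φ : NormGraphAut K L => Φ (1, 1)) h
  simp only [linearAut_apply, frobeniusAut_pow_apply, mul_one, one_pow, Prod.mk.injEq] at this
  have hu : u = 1 := Subtype.ext (Prod.ext (Units.ext this.1) this.2)
  rw [hu, map_one]

/-- The group generated by the Frobenius automorphism is cyclic of order `[L : 𝔽_p]`. -/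
theorem exists_cyc_hom_frobeniusAut (hQ : Nat.card L = p ^ d) :
    ∃ κ : Cyc d →* NormGraphAut K L, Function.Injective κ ∧
      (∀ c, ∃ i : ℕ, κ c = frobeniusAut K L p ^ i) ∧ ∀ i : ℕ, ∃ c, κ c = frobeniusAut K L p ^ i := by
  have : Finite K := Finite.of_injective _ (algebraMap K L).injective
  have : Finite (NormGraphAut K L) := Finite.of_injective (fun Φ => (Φ : L × Kˣ → L × Kˣ))
    DFunLike.coe_injective
  obtain ⟨e⟩ := nonempty_cyc_mulEquiv (G := Subgroup.zpowers (frobeniusAut K L p))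
    ((Nat.card_zpowers _).trans (orderOf_frobeniusAut hQ))
  refine ⟨(Subgroup.zpowers (frobeniusAut K L p)).subtype.comp e.toMonoidHom,
    Subtype.val_injective.comp e.injective, fun c => ?_, fun i => ?_⟩
  · obtain ⟨i, hi⟩ := mem_powers_iff_mem_zpowers.mpr (e c).2
    exact ⟨i, hi.symm⟩
  · obtain ⟨c, hc⟩ := e.surjective ⟨_, Subgroup.npow_mem_zpowers (frobeniusAut K L p) i⟩
    exact ⟨c, congrArg Subtype.val hc⟩

theorem exists_mem_Icc_frobeniusAut_pow (hQ : Nat.card L = p ^ d) (i : ℕ) :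
    ∃ j ∈ Finset.Icc 1 d, frobeniusAut K L p ^ i = frobeniusAut K L p ^ j := by
  have hord := orderOf_frobeniusAut (K := K) hQ
  have hd : 0 < d := by
    by_contra h
    have hL1 : 1 < Nat.card L := Finite.one_lt_card
    rw [hQ, Nat.eq_zero_of_not_pos h, pow_zero] at hL1
    omega
  have hlt := Nat.mod_lt i hd
  rw [← pow_mod_orderOf, hord]
  by_cases h : i % d = 0
  · refine ⟨d, by simp; omega, ?_⟩
    conv_rhs => rw [← hord]
    rw [h, pow_zero, pow_orderOf_eq_one]
  · exact ⟨i % d, by simp; omega, rfl⟩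

/-- For odd `q`, every automorphism is a product of a linear one and a Frobenius power. -/
theorem exists_eq_linearAut_mul (hq : q = p ^ k) (hK : Nat.card K = q)
    (hL : Module.finrank K L = n) (hn : n ≠ 0) (hq2 : 2 < q) (hp2 : p ≠ 2)
    (Φ : NormGraphAut K L) :
    ∃ (u : normSqPairs K L) (i : ℕ), Φ = linearAut K L p u * frobeniusAut K L p ^ i := by
  obtain ⟨a, γ, b, i, ha, hb, hΦ⟩ := Φ.exists_affine hq hK hL hn hq2
  have h2 : (2 : L) ≠ 0 := Ring.two_ne_zero (by rwa [ringChar.eq L p])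
  have hb0 : b = 0 := by
    rw [← two_mul] at hb
    exact (mul_eq_zero.mp hb).resolve_left h2
  refine ⟨⟨(a, γ), mem_normSqPairs.mpr ha⟩, i, RelIso.ext ?_⟩
  rintro ⟨X, x⟩
  rw [hΦ, RelIso.mul_apply, frobeniusAut_pow_apply, linearAut_apply, hb0, add_zero]

/-- For even `q`, every automorphism is a product of a translation, a linear automorphism and a
Frobenius power. -/
theorem exists_eq_translationAut_mul [CharP L 2] (hq : q = 2 ^ k) (hK : Nat.card K = q)
    (hL : Module.finrank K L = n) (hn : n ≠ 0) (hq2 : 2 < q) (Φ : NormGraphAut K L) :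
    ∃ (b : Multiplicative L) (u : normSqPairs K L) (i : ℕ),
      Φ = translationAut K L b * linearAut K L 2 u * frobeniusAut K L 2 ^ i := by
  obtain ⟨a, γ, b, i, ha, hb, hΦ⟩ := Φ.exists_affine hq hK hL hn hq2
  refine ⟨Multiplicative.ofAdd b, ⟨(a, γ), mem_normSqPairs.mpr ha⟩, i, RelIso.ext ?_⟩
  rintro ⟨X, x⟩
  rw [hΦ, RelIso.mul_apply, RelIso.mul_apply, frobeniusAut_pow_apply, linearAut_apply,
    translationAut_apply]
  rfl

/-- For odd `q`, the automorphism group is a semidirect product of the group of linear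
automorphisms and the group generated by the Frobenius. -/
theorem exists_mulEquiv_of_odd (hq : q = p ^ k) (hK : Nat.card K = q)
    (hL : Module.finrank K L = n) (hn : n ≠ 0) (hq2 : 2 < q) (hp2 : p ≠ 2)
    (hQ : Nat.card L = p ^ d) {A : Type*} [Group A] (e : A ≃* normSqPairs K L) :
    ∃ φ : Cyc d →* MulAut A, Nonempty (NormGraphAut K L ≃* A ⋊[φ] Cyc d) := by
  obtain ⟨κ, hκ, hκ1, hκ2⟩ := exists_cyc_hom_frobeniusAut (K := K) hQ
  refine SemidirectProduct.exists_mulEquiv ((linearAut K L p).comp e.toMonoidHom) κ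
    (linearAut_injective.comp e.injective) hκ (fun a c h => ?_) (fun c a => ?_) (fun Φ => ?_)
  · obtain ⟨i, hi⟩ := hκ1 c
    exact linearAut_eq_one_of_eq_frobeniusAut_pow (h.trans hi)
  · obtain ⟨i, hi⟩ := hκ1 c
    refine ⟨e.symm (e a ^ p ^ i), ?_⟩
    rw [hi]
    simpa [-map_pow] using frobeniusAut_pow_mul_linearAut i (e a)
  · obtain ⟨u, i, rfl⟩ := exists_eq_linearAut_mul hq hK hL hn hq2 hp2 Φ
    obtain ⟨c, hc⟩ := hκ2 i
    exact ⟨e.symm u, c, by simp [hc]⟩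

/-- The additive group of a finite field as a power of the cyclic group of order `p`. -/
theorem nonempty_pi_cyc_mulEquiv (hQ : Nat.card L = p ^ d) :
    Nonempty ((Fin d → Cyc p) ≃* Multiplicative L) := by
  let := ZMod.algebra L p
  have hd : Module.finrank (ZMod p) L = d := by
    have h := Module.natCard_eq_pow_finrank (K := ZMod p) (V := L)
    rw [hQ, Nat.card_zmod] at h
    exact (Nat.pow_right_injective (Fact.out : p.Prime).two_le h).symm
  exact ⟨(MulEquiv.piMultiplicative fun _ : Fin d => ZMod p).symm.trans
    (Module.finBasisOfFinrankEq (ZMod p) L hd).equivFun.symm.toAddEquiv.toMultiplicative⟩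

/-- For even `q`, the automorphism group is an iterated semidirect product of the groups of
translations, of linear automorphisms, and the group generated by the Frobenius. -/
theorem exists_mulEquiv_of_even [CharP L 2] (hq : q = 2 ^ k) (hK : Nat.card K = q)
    (hL : Module.finrank K L = n) (hn : n ≠ 0) (hq2 : 2 < q)
    (hQ : Nat.card L = 2 ^ d) {A B : Type*} [Group A] [Group B] (e : A ≃* Multiplicative L)
    (e' : B ≃* normSqPairs K L) :
    ∃ (ψ : B →* MulAut A) (φ : Cyc d →* MulAut (A ⋊[ψ] B)),
      Nonempty (NormGraphAut K L ≃* (A ⋊[ψ] B) ⋊[φ] Cyc d) := by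
  obtain ⟨κ, hκ, hκ1, hκ2⟩ := exists_cyc_hom_frobeniusAut (K := K) hQ
  have hzero {b : Multiplicative L} {Φ : NormGraphAut K L} (h : translationAut K L b = Φ)
      (h0 : (Φ (0, 1)).1 = 0) : b = 1 := by
    rw [← h, translationAut_apply, zero_add] at h0
    exact h0
  refine SemidirectProduct.exists_mulEquiv_triple ((translationAut K L).comp e.toMonoidHom)
    ((linearAut K L 2).comp e'.toMonoidHom) κ (translationAut_injective.comp e.injective)
    (linearAut_injective.comp e'.injective) hκ (fun a b h => ?_) (fun a b c h => ?_)
    (fun b a => ?_) (fun c a => ?_) (fun c b => ?_) (fun Φ => ?_)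
  · have h' : translationAut K L (e a) = linearAut K L 2 (e' b) := h
    have := hzero h' (by simp [linearAut_apply])
    change translationAut K L (e a) = 1
    rw [this, map_one]
  · obtain ⟨i, hi⟩ := hκ1 c
    have h' : translationAut K L (e a) * linearAut K L 2 (e' b) = frobeniusAut K L 2 ^ i :=
      h.trans hi
    have h1 : e a = 1 := by
      have := congrArg (fun Φ : NormGraphAut K L => (Φ (0, 1)).1) h'
      simpa [RelIso.mul_apply, linearAut_apply, translationAut_apply, frobeniusAut_pow_apply]
        using this
    change translationAut K L (e a) * linearAut K L 2 (e' b) = 1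
    rw [h1, map_one, one_mul] at h' ⊢
    exact linearAut_eq_one_of_eq_frobeniusAut_pow h'
  · refine ⟨e.symm (Multiplicative.ofAdd ((e' b).1.1 * (e a).toAdd)), ?_⟩
    simpa using linearAut_mul_translationAut (e' b) (e a)
  · obtain ⟨i, hi⟩ := hκ1 c
    refine ⟨e.symm (Multiplicative.ofAdd ((e a).toAdd ^ 2 ^ i)), ?_⟩
    rw [hi]
    simpa using frobeniusAut_pow_mul_translationAut (K := K) i (e a)
  · obtain ⟨i, hi⟩ := hκ1 c
    refine ⟨e'.symm (e' b ^ 2 ^ i), ?_⟩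
    rw [hi]
    simpa [-map_pow] using frobeniusAut_pow_mul_linearAut (p := 2) i (e' b)
  · obtain ⟨b, u, i, rfl⟩ := exists_eq_translationAut_mul hq hK hL hn hq2 Φ
    obtain ⟨c, hc⟩ := hκ2 i
    exact ⟨e.symm b, e'.symm u, c, by simp [hc]⟩

end Structure

theorem theorem4 (p k q t : ℕ) (hp : p.Prime) (hk : 1 ≤ k) (hq : q = p ^ k) (ht : 2 ≤ t)
    (K L : Type*) [Field K] [Field L] [Algebra K L]
    (hK : Nat.card K = q) (hL : Module.finrank K L = t - 1) :
    -- for odd `q` these maps are automorphisms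
    (Odd q → ∀ C : Lˣ, ∀ ε : Kˣ, (ε = 1 ∨ ε = -1) → ∀ i ∈ Finset.Icc 1 (k * (t - 1)),
      ∃ Φ : NormGraphAut K L, ∀ (X : L) (x : Kˣ),
        Φ (X, x) = ((C : L) ^ 2 * X ^ p ^ i, ε * unitNorm K C * x ^ p ^ i)) ∧
    -- for even `q` these maps are automorphisms
    (Even q → ∀ C : Lˣ, ∀ A : L, ∀ i ∈ Finset.Icc 1 (k * (t - 1)),
      ∃ Φ : NormGraphAut K L, ∀ (X : L) (x : Kˣ),
        Φ (X, x) = ((C : L) ^ 2 * X ^ p ^ i + A, unitNorm K C * x ^ p ^ i)) ∧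
    (2 < q →
      -- for `q > 2` there are no other automorphisms
      (Odd q → ∀ Φ : NormGraphAut K L,
        ∃ C : Lˣ, ∃ ε : Kˣ, (ε = 1 ∨ ε = -1) ∧ ∃ i ∈ Finset.Icc 1 (k * (t - 1)),
          ∀ (X : L) (x : Kˣ),
            Φ (X, x) = ((C : L) ^ 2 * X ^ p ^ i, ε * unitNorm K C * x ^ p ^ i)) ∧
      (Even q → ∀ Φ : NormGraphAut K L,
        ∃ C : Lˣ, ∃ A : L, ∃ i ∈ Finset.Icc 1 (k * (t - 1)),
          ∀ (X : L) (x : Kˣ),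
            Φ (X, x) = ((C : L) ^ 2 * X ^ p ^ i + A, unitNorm K C * x ^ p ^ i)) ∧
      -- the structure of the automorphism group
      (Odd q → Odd (t - 1) →
        ∃ φ : Cyc (k * (t - 1)) →* MulAut (Cyc (q ^ (t - 1) - 1)),
          Nonempty (NormGraphAut K L ≃* (Cyc (q ^ (t - 1) - 1) ⋊[φ] Cyc (k * (t - 1))))) ∧
      (Odd q → Even (t - 1) →
        ∃ φ : Cyc (k * (t - 1)) →* MulAut (Cyc 2 × Cyc ((q ^ (t - 1) - 1) / 2)),
          Nonempty (NormGraphAut K L ≃*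
            ((Cyc 2 × Cyc ((q ^ (t - 1) - 1) / 2)) ⋊[φ] Cyc (k * (t - 1))))) ∧
      (Even q →
        ∃ ψ : Cyc (q ^ (t - 1) - 1) →* MulAut (Fin (k * (t - 1)) → Cyc p),
        ∃ φ : Cyc (k * (t - 1)) →*
            MulAut ((Fin (k * (t - 1)) → Cyc p) ⋊[ψ] Cyc (q ^ (t - 1) - 1)),
          Nonempty (NormGraphAut K L ≃*
            (((Fin (k * (t - 1)) → Cyc p) ⋊[ψ] Cyc (q ^ (t - 1) - 1)) ⋊[φ]
              Cyc (k * (t - 1)))))) := by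
  subst hq
  have : Fact p.Prime := ⟨hp⟩
  have hp1 : 1 < p := hp.one_lt
  have hfinK : Finite K := Nat.finite_of_card_ne_zero (by rw [hK]; positivity)
  have hfinKL : Module.Finite K L := Module.finite_of_finrank_pos (by omega)
  have hfinL : Finite L := Module.finite_of_finite K
  have hn : t - 1 ≠ 0 := by omega
  have hcardL : Nat.card L = (p ^ k) ^ (t - 1) := by
    rw [Module.natCard_eq_pow_finrank (K := K), hK, hL]
  have hQ : Nat.card L = p ^ (k * (t - 1)) := by rw [hcardL, pow_mul]
  have hchar : CharP L p := by
    have := Fintype.ofFinite L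
    exact charP_of_card_eq_prime_pow (by rw [← Nat.card_eq_fintype_card, hQ])
  have hunits : Nat.card Lˣ = (p ^ k) ^ (t - 1) - 1 := by rw [Nat.card_units, hcardL]
  have hodd : Odd (p ^ k) → p ≠ 2 := by
    rintro h rfl
    exact Nat.not_odd_iff_even.mpr (even_two.pow_of_ne_zero (by omega)) h
  have heven : Even (p ^ k) → p = 2 := fun h => hp.even_iff.mp (Nat.even_pow.mp h).1
  refine ⟨?_, ?_, fun hq2 => ⟨?_, ?_, ?_, ?_, ?_⟩⟩
  · intro _ C ε hε i _
    have hu : ((C ^ 2, ε * unitNorm K C) : Lˣ × Kˣ) ∈ normSqPairs K L := by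
      change unitNorm K (C ^ 2) = (ε * unitNorm K C) ^ 2
      have hε2 : ε ^ 2 = 1 := by rcases hε with rfl | rfl <;> simp
      rw [mul_pow, hε2, one_mul, sq, unitNorm_mul, sq]
    exact ⟨affineAut p ⟨_, hu⟩ 0 (add_zero 0) i, fun X x => by simp [affineAut_apply]⟩
  · intro h C A i _
    obtain rfl := heven h
    refine ⟨affineAut 2 (sqNorm C) A (CharTwo.add_self_eq_zero A) i, fun X x => ?_⟩
    rw [affineAut_apply]
    simp [sqNorm]
  · intro h Φ
    obtain ⟨u, i, rfl⟩ := exists_eq_linearAut_mul rfl hK hL hn hq2 (hodd h) Φ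
    obtain ⟨j, hj, hij⟩ := exists_mem_Icc_frobeniusAut_pow (K := K) hQ i
    obtain ⟨C, hC, hε⟩ := exists_sq_of_mem_normSqPairs u.2
    have hε' : ∃ ε : Kˣ, (ε = 1 ∨ ε = -1) ∧ u.1.2 = ε * unitNorm K C := by
      rcases hε with h | h
      · exact ⟨1, Or.inl rfl, by rw [h, one_mul]⟩
      · exact ⟨-1, Or.inr rfl, by rw [h, neg_one_mul]⟩
    obtain ⟨ε, hε1, hε2⟩ := hε'
    refine ⟨C, ε, hε1, j, hj, fun X x => ?_⟩
    rw [hij, RelIso.mul_apply, frobeniusAut_pow_apply, linearAut_apply, hC, hε2]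
    simp
  · intro h Φ
    obtain rfl := heven h
    obtain ⟨b, u, i, rfl⟩ := exists_eq_translationAut_mul rfl hK hL hn hq2 Φ
    obtain ⟨j, hj, hij⟩ := exists_mem_Icc_frobeniusAut_pow (K := K) hQ i
    obtain ⟨C, rfl⟩ := sqNorm_bijective_of_char_two.2 u
    refine ⟨C, b.toAdd, j, hj, fun X x => ?_⟩
    rw [hij, RelIso.mul_apply, RelIso.mul_apply, frobeniusAut_pow_apply, linearAut_apply,
      translationAut_apply]
    simp [sqNorm]
  · intro h hn'
    obtain ⟨e⟩ := nonempty_cyc_mulEquiv hunits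
    exact exists_mulEquiv_of_odd rfl hK hL hn hq2 (hodd h) hQ
      (e.trans (MulEquiv.ofBijective _
        (sqNorm_bijective_of_odd (hK ▸ h) (hL ▸ hn'))))
  · intro h hn'
    obtain ⟨e⟩ := nonempty_normSqPairs_mulEquiv (K := K) (L := L) (hK ▸ h) (hL ▸ hn')
    rw [hcardL] at e
    exact exists_mulEquiv_of_odd rfl hK hL hn hq2 (hodd h) hQ e
  · intro h
    obtain rfl := heven h
    obtain ⟨e⟩ := nonempty_pi_cyc_mulEquiv hQ
    obtain ⟨e'⟩ := nonempty_cyc_mulEquiv hunits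
    exact exists_mulEquiv_of_even rfl hK hL hn hq2 hQ e
      (e'.trans (MulEquiv.ofBijective _ sqNorm_bijective_of_char_two))
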